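/- Consider the problem $P|\mathrm{prec},p_j=1|C_{\max}$: given $n$ unit-length jobs, a number $m\ge 1$ of identical machines, and precedence constraints in the form of a strict partial order $\prec$ on the jobs (given by its full adjacency matrix), find a schedule of minimum makespan, that is, the least $T$ together with an assignment of the jobs to time slots $1,\dots,T$ such that every slot receives at most $m$ jobs and $v\prec w$ implies that $v$ is placed in a strictly earlier slot than $w$. Let $\#\mathrm{AC}$ be the number of antichains of $\prec$, i.e. of sets of pairwise incomparable jobs (the empty set included). **Theorem.** $P|\mathrm{prec},p_j=1|C_{\max}$ can be solved in time $\mathcal{O}^{\star}(2^{n-m}+\#\mathrm{AC})$. Explicitly: there are one random access machine program and one polynomial $p$ such that, on every instance, the program halts with the minimum makespan and a schedule attaining it, and its running time (with logarithmic cost: each operation is charged the bit lengths of the numbers and addresses involved) is at most $p(N)\cdot\bigl(2^{n-m}+\#\mathrm{AC}\bigr)$, where $N$ is the input size in bits (that of the adjacency matrix and of $n$ and $m$ in binary). -/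

import Mathlib

/-! ## Random access machines with logarithmic cost

The machine has registers and a main memory, both holding natural numbers. A program is a fixed
finite text, so it names only finitely many registers; memory is addressed indirectly. Every basic
operation is charged the bit lengths of the numbers and addresses it handles. -/

namespace RAM

/-- A machine configuration: contents of the registers and of the memory cells. -/
structure State where
  reg : ℕ → ℕ
  mem : ℕ → ℕ

/-- Arithmetic operations: addition, truncated subtraction, multiplication and division with
remainder discarded (division by zero yields zero). -/
inductive Op where
  | add
  | sub
  | mul
  | div

def Op.eval : Op → ℕ → ℕ → ℕ
  | .add, a, b => a + b
  | .sub, a, b => a - b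
  | .mul, a, b => a * b
  | .div, a, b => a / b

/-- Expressions: a constant, the content of a register, the content of the memory cell with a
computed address, or an arithmetic operation. -/
inductive Expr where
  | const (c : ℕ)
  | reg (i : ℕ)
  | load (a : Expr)
  | op (o : Op) (a b : Expr)

def Expr.eval (s : State) : Expr → ℕ
  | .const c => c
  | .reg i => s.reg i
  | .load a => s.mem (a.eval s)
  | .op o a b => o.eval (a.eval s) (b.eval s)

/-- Logarithmic cost of evaluating an expression (`Nat.size` is the number of binary digits). -/
def Expr.cost (s : State) : Expr → ℕ
  | .const c => 1 + c.size
  | .reg i => 1 + (s.reg i).size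
  | .load a => a.cost s + 1 + (a.eval s).size + (s.mem (a.eval s)).size
  | .op _ a b => a.cost s + b.cost s + 1 + (a.eval s).size + (b.eval s).size

/-- Programs. A test succeeds when the value of its expression is nonzero. -/
inductive Cmd where
  | skip
  | assign (i : ℕ) (e : Expr)
  | store (a e : Expr)
  | seq (c d : Cmd)
  | ite (e : Expr) (c d : Cmd)
  | while (e : Expr) (c : Cmd)

/-- `Exec c s s' t`: started in configuration `s`, the program `c` halts in configuration `s'`,
and the total logarithmic cost of the run (its running time) is `t`. -/
inductive Exec : Cmd → State → State → ℕ → Prop where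
  | skip (s : State) : Exec .skip s s 1
  | assign (i : ℕ) (e : Expr) (s : State) :
      Exec (.assign i e) s ⟨Function.update s.reg i (e.eval s), s.mem⟩
        (e.cost s + 1 + (e.eval s).size)
  | store (a e : Expr) (s : State) :
      Exec (.store a e) s ⟨s.reg, Function.update s.mem (a.eval s) (e.eval s)⟩
        (a.cost s + e.cost s + 1 + (a.eval s).size + (e.eval s).size)
  | seq {c d : Cmd} {s s' s'' : State} {t t' : ℕ} :
      Exec c s s' t → Exec d s' s'' t' → Exec (.seq c d) s s'' (t + t')
  | iteTrue {e : Expr} {c d : Cmd} {s s' : State} {t : ℕ} :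
      e.eval s ≠ 0 → Exec c s s' t → Exec (.ite e c d) s s' (e.cost s + 1 + t)
  | iteFalse {e : Expr} {c d : Cmd} {s s' : State} {t : ℕ} :
      e.eval s = 0 → Exec d s s' t → Exec (.ite e c d) s s' (e.cost s + 1 + t)
  | whileFalse {e : Expr} {c : Cmd} {s : State} :
      e.eval s = 0 → Exec (.while e c) s s (e.cost s + 1)
  | whileTrue {e : Expr} {c : Cmd} {s s' s'' : State} {t t' : ℕ} :
      e.eval s ≠ 0 → Exec c s s' t → Exec (.while e c) s' s'' t' →
        Exec (.while e c) s s'' (e.cost s + 1 + t + t')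

/-- The machine is deterministic: result and running time are determined by the input. -/
theorem Exec.deterministic {c : Cmd} {s s₁ s₂ : State} {t₁ t₂ : ℕ}
    (h₁ : Exec c s s₁ t₁) (h₂ : Exec c s s₂ t₂) : s₁ = s₂ ∧ t₁ = t₂ := by
  induction h₁ generalizing s₂ t₂ with
  | skip => cases h₂; exact ⟨rfl, rfl⟩
  | assign => cases h₂; exact ⟨rfl, rfl⟩
  | store => cases h₂; exact ⟨rfl, rfl⟩
  | seq _ _ ih ih' =>
    cases h₂ with
    | seq k k' =>
      obtain ⟨rfl, rfl⟩ := ih k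
      obtain ⟨rfl, rfl⟩ := ih' k'
      exact ⟨rfl, rfl⟩
  | iteTrue he _ ih =>
    cases h₂ with
    | iteTrue _ k => obtain ⟨rfl, rfl⟩ := ih k; exact ⟨rfl, rfl⟩
    | iteFalse h0 _ => exact absurd h0 he
  | iteFalse he _ ih =>
    cases h₂ with
    | iteTrue h0 _ => exact absurd he h0
    | iteFalse _ k => obtain ⟨rfl, rfl⟩ := ih k; exact ⟨rfl, rfl⟩
  | whileFalse he =>
    cases h₂ with
    | whileFalse _ => exact ⟨rfl, rfl⟩
    | whileTrue h0 _ _ => exact absurd he h0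
  | whileTrue he _ _ ih ih' =>
    cases h₂ with
    | whileFalse h0 => exact absurd h0 he
    | whileTrue _ k k' =>
      obtain ⟨rfl, rfl⟩ := ih k
      obtain ⟨rfl, rfl⟩ := ih' k'
      exact ⟨rfl, rfl⟩

end RAM

/-! ## Scheduling unit jobs with precedence constraints on identical machines

The jobs are the elements of `Fin n`; `prec i j` means that job `i` must be completed before job
`j` starts. -/

namespace Sched

/-- `σ` assigns to every job its time slot among `1, …, T`; the sets `S_t = {j | σ j = t}` form a
schedule on `m` machines with makespan `T`. -/
structure IsSchedule {n : ℕ} (prec : Fin n → Fin n → Prop) (m T : ℕ) (σ : Fin n → ℕ) :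
    Prop where
  one_le : ∀ j, 1 ≤ σ j
  le_makespan : ∀ j, σ j ≤ T
  card_slot_le : ∀ t, (Finset.univ.filter fun j => σ j = t).card ≤ m
  lt_of_prec : ∀ i j, prec i j → σ i < σ j

/-- A schedule of minimum makespan. -/
def IsOptimalSchedule {n : ℕ} (prec : Fin n → Fin n → Prop) (m T : ℕ) (σ : Fin n → ℕ) : Prop :=
  IsSchedule prec m T σ ∧ ∀ (T' : ℕ) (σ' : Fin n → ℕ), IsSchedule prec m T' σ' → T ≤ T'

/-- The number of antichains (sets of pairwise incomparable jobs). -/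
noncomputable def numAntichains {n : ℕ} (prec : Fin n → Fin n → Prop) : ℕ :=
  {X : Finset (Fin n) | IsAntichain prec (X : Set (Fin n))}.ncard

open Classical in
/-- The initial configuration: register `0` holds `n`, register `1` holds `m`, memory cell
`i * n + j` holds the entry `(i, j)` of the adjacency matrix of `prec` (for `i, j < n`), and
everything else is zero. -/
noncomputable def inputState (n m : ℕ) (prec : Fin n → Fin n → Prop) : RAM.State where
  reg k := if k = 0 then n else if k = 1 then m else 0
  mem a := if ∃ i j : Fin n, a = (i : ℕ) * n + j ∧ prec i j then 1 else 0

/-- The size of the input in bits: the adjacency matrix together with `n` and `m` in binary. -/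
def inputSize (n m : ℕ) : ℕ := n ^ 2 + n.size + m.size

end Sched

/-! ### Running time of straight-line code and of loops -/

/-! The program is a dynamic program whose states are pairs of a lower set of jobs and the job added
last. The value of a state is the least position found for its last job, where positions 1, 2, 3, …
are cut into slots of `m`. The crux is that the content of the current slot need not be remembered.
Call the number of predecessors of a job its rank. A new slot is opened whenever the next job has
larger rank than the last one, and otherwise the next position is taken.

Soundness (`SearchInv.exists_plan`): ranks do not increase within a slot, while `u ≺ v` forces rank
`u` < rank `v` (`IsJobOrder.rank_lt`). So comparable jobs never share a slot, and since only lower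
sets are extended, they come in the right order. Completeness (`SearchInv.exists_le`): list the jobs
of any schedule by slot and, within a slot, by decreasing rank. Adding them in this order, the rule
opens no new slot inside a slot of the given schedule, so the value never exceeds the end of the
slot that the schedule uses.

A lower set is determined by the antichain of its maximal elements, so at most `numAntichains * (n +
1)` states are found (`sizeBound_natPrec`). Each is treated with polynomially many operations on
words of length linear in the input. This gives the bound polynomial times the number of antichains;
the summand `2 ^ (n - m)` is only added at the very end.

On the machine, the states form a breadth-first queue, so values are final when their state is
extended. Running times are obtained by bounding loop-free code by a static weight times the word
length (`Cmd.Fits.runs`) and counting passes of loops (`Runs.while`). -/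

namespace RAM

/-- A static bound for the logarithmic cost of an expression, and for the size of its value, as a
multiple of the word length. -/
def Expr.weight : Expr → ℕ
  | .const c => 1 + c.size
  | .reg _ => 1
  | .load a => 2 * a.weight + 1
  | .op _ a b => 2 * a.weight + 2 * b.weight + 1

/-- A static bound for the cost of straight-line code, as a multiple of the word length. -/
def Cmd.weight : Cmd → ℕ
  | .skip => 1
  | .assign _ e => 2 * e.weight + 1
  | .store a e => 2 * a.weight + 2 * e.weight + 1
  | .seq c d => c.weight + d.weight
  | .ite e c d => e.weight + 1 + c.weight + d.weight
  | .while _ _ => 0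

/-- The effect of straight-line code. -/
def Cmd.sim : Cmd → State → State
  | .skip, s => s
  | .assign i e, s => ⟨Function.update s.reg i (e.eval s), s.mem⟩
  | .store a e, s => ⟨s.reg, Function.update s.mem (a.eval s) (e.eval s)⟩
  | .seq c d, s => d.sim (c.sim s)
  | .ite e c d, s => if e.eval s ≠ 0 then c.sim s else d.sim s
  | .while _ _, s => s

/-- The code contains no loop, and every number it stores when started in the given configuration
is at most `M`. -/
def Cmd.Fits (M : ℕ) : Cmd → State → Prop
  | .skip, _ => True
  | .assign _ e, s => e.eval s ≤ M
  | .store _ e, s => e.eval s ≤ M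
  | .seq c d, s => c.Fits M s ∧ d.Fits M (c.sim s)
  | .ite e c d, s => (e.eval s ≠ 0 → c.Fits M s) ∧ (e.eval s = 0 → d.Fits M s)
  | .while _ _, _ => False

/-- All registers and memory cells hold numbers at most `M`. -/
structure State.Bounded (M : ℕ) (s : State) : Prop where
  reg : ∀ i, s.reg i ≤ M
  mem : ∀ a, s.mem a ≤ M

/-- Started in `s`, the command halts in `s'` at cost at most `k` times the word length. -/
def Runs (M : ℕ) (c : Cmd) (s s' : State) (k : ℕ) : Prop :=
  ∃ t, Exec c s s' t ∧ t ≤ k * (M.size + 1)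

theorem size_le_size_add_size_of_op (o : Op) (a b : ℕ) :
    (o.eval a b).size ≤ a.size + b.size + 1 := by
  rw [Nat.size_le]
  have ha := Nat.lt_size_self a
  have hb := Nat.lt_size_self b
  have h1 : 2 ^ a.size ≤ 2 ^ (a.size + b.size) := Nat.pow_le_pow_right (by norm_num) (by omega)
  have h2 : 2 ^ b.size ≤ 2 ^ (a.size + b.size) := Nat.pow_le_pow_right (by norm_num) (by omega)
  have h3 : 2 ^ (a.size + b.size + 1) = 2 * 2 ^ (a.size + b.size) := by ring
  cases o with
  | add => simp only [Op.eval]; omega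
  | sub => simp only [Op.eval]; omega
  | mul =>
    simp only [Op.eval]
    have := Nat.mul_lt_mul'' ha hb
    rw [← pow_add] at this
    omega
  | div =>
    simp only [Op.eval]
    have := Nat.div_le_self a b
    omega

/-- Both bounds are proved together because loads and operations are charged the lengths of
intermediate values; this is why `weight` doubles at inner nodes. Intermediate values and addresses
may exceed `M`, only their length matters. -/
theorem Expr.cost_le_and_size_le {M : ℕ} {s : State} (hs : s.Bounded M) (e : Expr) :
    e.cost s ≤ e.weight * (M.size + 1) ∧ (e.eval s).size ≤ e.weight * (M.size + 1) := by
  induction e with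
  | const c =>
    simp only [Expr.cost, Expr.eval, Expr.weight]
    constructor <;> nlinarith [Nat.zero_le (c.size * M.size)]
  | reg i =>
    simp only [Expr.cost, Expr.eval, Expr.weight]
    have := Nat.size_le_size (hs.reg i)
    omega
  | load a ih =>
    simp only [Expr.cost, Expr.eval, Expr.weight]
    have := Nat.size_le_size (hs.mem (a.eval s))
    have h : (2 * a.weight + 1) * (M.size + 1)
      = 2 * (a.weight * (M.size + 1)) + (M.size + 1) := by ring
    rw [h]
    omega
  | op o a b iha ihb =>
    simp only [Expr.cost, Expr.eval, Expr.weight]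
    have := size_le_size_add_size_of_op o (a.eval s) (b.eval s)
    have h : (2 * a.weight + 2 * b.weight + 1) * (M.size + 1)
      = 2 * (a.weight * (M.size + 1)) + 2 * (b.weight * (M.size + 1)) + (M.size + 1) := by ring
    rw [h]
    omega

theorem Expr.cost_add_one_le {M : ℕ} {s : State} (hs : s.Bounded M) (e : Expr) :
    e.cost s + 1 ≤ (e.weight + 1) * (M.size + 1) := by
  have := (e.cost_le_and_size_le hs).1
  rw [add_mul]
  omega

theorem State.Bounded.assign {M : ℕ} {s : State} (hs : s.Bounded M) (i : ℕ) {x : ℕ}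
    (hx : x ≤ M) : State.Bounded M ⟨Function.update s.reg i x, s.mem⟩ := by
  refine ⟨fun j => ?_, hs.mem⟩
  by_cases h : j = i
  · subst h; simpa using hx
  · simpa [Function.update_of_ne h] using hs.reg j

theorem State.Bounded.store {M : ℕ} {s : State} (hs : s.Bounded M) (a : ℕ) {x : ℕ}
    (hx : x ≤ M) : State.Bounded M ⟨s.reg, Function.update s.mem a x⟩ := by
  refine ⟨hs.reg, fun j => ?_⟩
  by_cases h : j = a
  · subst h; simpa using hx
  · simpa [Function.update_of_ne h] using hs.mem j

theorem Runs.mono {M : ℕ} {c : Cmd} {s s' : State} {k k' : ℕ} (h : Runs M c s s' k)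
    (hk : k ≤ k') : Runs M c s s' k' := by
  obtain ⟨t, ht, htk⟩ := h
  exact ⟨t, ht, htk.trans (Nat.mul_le_mul_right _ hk)⟩

theorem Runs.seq {M : ℕ} {c d : Cmd} {s s' s'' : State} {k l : ℕ} (h : Runs M c s s' k)
    (h' : Runs M d s' s'' l) : Runs M (.seq c d) s s'' (k + l) := by
  obtain ⟨t, ht, htk⟩ := h
  obtain ⟨t', ht', htk'⟩ := h'
  refine ⟨t + t', .seq ht ht', ?_⟩
  rw [add_mul]
  omega

theorem Runs.ite_true {M : ℕ} {e : Expr} {c d : Cmd} {s s' : State} {k : ℕ} (hs : s.Bounded M)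
    (he : e.eval s ≠ 0) (h : Runs M c s s' k) : Runs M (.ite e c d) s s' (e.weight + 1 + k) := by
  obtain ⟨t, ht, htk⟩ := h
  have := e.cost_add_one_le hs
  refine ⟨_, .iteTrue he ht, ?_⟩
  rw [add_mul]
  omega

theorem Runs.ite_false {M : ℕ} {e : Expr} {c d : Cmd} {s s' : State} {k : ℕ} (hs : s.Bounded M)
    (he : e.eval s = 0) (h : Runs M d s s' k) : Runs M (.ite e c d) s s' (e.weight + 1 + k) := by
  obtain ⟨t, ht, htk⟩ := h
  have := e.cost_add_one_le hs
  refine ⟨_, .iteFalse he ht, ?_⟩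
  rw [add_mul]
  omega

/-- Straight-line code runs within its weight. -/
theorem Cmd.Fits.runs {M : ℕ} {c : Cmd} {s : State} (h : c.Fits M s) (hs : s.Bounded M) :
    Runs M c s (c.sim s) c.weight ∧ (c.sim s).Bounded M := by
  induction c generalizing s with
  | skip => exact ⟨⟨1, .skip s, by simp [Cmd.weight]⟩, hs⟩
  | assign i e =>
    refine ⟨⟨_, .assign i e s, ?_⟩, hs.assign i h⟩
    have := e.cost_le_and_size_le hs
    have h' : (2 * e.weight + 1) * (M.size + 1)
      = 2 * (e.weight * (M.size + 1)) + (M.size + 1) := by ring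
    rw [Cmd.weight, h']
    omega
  | store a e =>
    refine ⟨⟨_, .store a e s, ?_⟩, hs.store _ h⟩
    have := e.cost_le_and_size_le hs
    have := a.cost_le_and_size_le hs
    have h' : (2 * a.weight + 2 * e.weight + 1) * (M.size + 1)
      = 2 * (a.weight * (M.size + 1)) + 2 * (e.weight * (M.size + 1)) + (M.size + 1) := by ring
    rw [Cmd.weight, h']
    omega
  | seq c d ihc ihd =>
    obtain ⟨h1, h2⟩ := ihc h.1 hs
    obtain ⟨h3, h4⟩ := ihd h.2 h2
    exact ⟨h1.seq h3, h4⟩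
  | ite e c d ihc ihd =>
    by_cases h0 : e.eval s = 0
    · obtain ⟨h1, h2⟩ := ihd (h.2 h0) hs
      simp only [Cmd.sim, h0, ne_eq, not_true_eq_false, if_false]
      exact ⟨(h1.ite_false hs h0).mono (by rw [Cmd.weight]; omega), h2⟩
    · obtain ⟨h1, h2⟩ := ihc (h.1 h0) hs
      simp only [Cmd.sim, h0, ne_eq, not_false_eq_true, if_true]
      exact ⟨(h1.ite_true hs h0).mono (by rw [Cmd.weight]; omega), h2⟩
  | _ => exact h.elim

/-- A loop with an invariant `Inv`, whose first argument counts the passes and is bounded by `N`. -/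
theorem Runs.while {M : ℕ} {e : Expr} {c : Cmd} (Inv : ℕ → State → Prop) (N B : ℕ)
    (hbd : ∀ k s, Inv k s → s.Bounded M) (hN : ∀ k s, Inv k s → k ≤ N)
    (hstep : ∀ k s, Inv k s → e.eval s ≠ 0 → ∃ s', Runs M c s s' B ∧ Inv (k + 1) s')
    {s : State} (h0 : Inv 0 s) :
    ∃ k s', Runs M (.while e c) s s' ((N + 1) * (e.weight + 1 + B)) ∧ Inv k s' ∧
      e.eval s' = 0 := by
  suffices H : ∀ r k s, r + k = N → Inv k s →
      ∃ k s', Runs M (.while e c) s s' ((r + 1) * (e.weight + 1 + B)) ∧ Inv k s' ∧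
        e.eval s' = 0 from H N 0 s rfl h0
  intro r
  induction r with
  | zero =>
    intro k s hk hI
    by_cases he : e.eval s = 0
    · refine ⟨k, s, ⟨_, .whileFalse he, ?_⟩, hI, he⟩
      refine (e.cost_add_one_le (hbd k s hI)).trans (Nat.mul_le_mul_right _ ?_)
      omega
    -- Here `k = N`, so another pass would violate `hN`.
    · obtain ⟨s', -, hI'⟩ := hstep k s hI he
      have := hN _ _ hI'
      omega
  | succ r ih =>
    intro k s hk hI
    have hc := e.cost_add_one_le (hbd k s hI)
    by_cases he : e.eval s = 0
    · refine ⟨k, s, ⟨_, .whileFalse he, ?_⟩, hI, he⟩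
      refine hc.trans (Nat.mul_le_mul_right _ ?_)
      nlinarith [Nat.zero_le (r * (e.weight + 1 + B))]
    · obtain ⟨s', ⟨t, ht, htB⟩, hI'⟩ := hstep k s hI he
      obtain ⟨k', s'', ⟨t', ht', htB'⟩, hI'', he'⟩ := ih (k + 1) s' (by omega) hI'
      refine ⟨k', s'', ⟨_, .whileTrue he ht ht', ?_⟩, hI'', he'⟩
      have : (r + 1 + 1) * (e.weight + 1 + B) * (M.size + 1)
        = (r + 1) * (e.weight + 1 + B) * (M.size + 1)
          + (e.weight + 1) * (M.size + 1) + B * (M.size + 1) := by ring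
      omega

end RAM

/-! ### The dynamic program over pairs of a lower set and the job added last -/

namespace Sched

open Finset

/-- The set of jobs encoded by the configuration `s = D * n + l`, where `D` is a bit mask and `l`
the job added last. -/
def jobs (n s : ℕ) : Finset ℕ := (s / n).bitIndices.toFinset

/-- The configuration reached from `s` by adding the job `v`. -/
def ext (n s v : ℕ) : ℕ := (s / n + 2 ^ v) * n + v

/-- The slot of the `p`-th position, when every slot has `m` positions. -/
def slot (m p : ℕ) : ℕ := (p + m - 1) / m

/-- The number of predecessors. -/
def rank (n : ℕ) (R : ℕ → ℕ → Prop) [DecidableRel R] (v : ℕ) : ℕ := #{u ∈ range n | R u v}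

/-- The position of job `v` if it is added after job `l`, which has position `p`: a new slot is
opened when `v` has more predecessors than `l`. -/
def nextPos (n m : ℕ) (R : ℕ → ℕ → Prop) [DecidableRel R] (l v p : ℕ) : ℕ :=
  if rank n R l < rank n R v then m * slot m p + 1 else p + 1

/-- The job `v` can be added to the configuration `s`. -/
def Addable (n : ℕ) (R : ℕ → ℕ → Prop) (s v : ℕ) : Prop :=
  v ∉ jobs n s ∧ ∀ u ∈ range n, R u v → u ∈ jobs n s

instance (n : ℕ) (R : ℕ → ℕ → Prop) [DecidableRel R] (s v : ℕ) : Decidable (Addable n R s v) := by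
  unfold Addable; infer_instance

/-- The tables of the dynamic program: the queue of the configurations found so far, and for every
configuration the least position of its last job (zero if not found) and its predecessor. -/
structure Tables where
  size : ℕ
  queue : ℕ → ℕ
  val : ℕ → ℕ
  par : ℕ → ℕ

/-- Record that `s'` can be reached from `s` with position `p`. -/
def Tables.record (T : Tables) (s s' p : ℕ) : Tables :=
  if T.val s' = 0 then
    ⟨T.size + 1, Function.update T.queue T.size s', Function.update T.val s' p,
      Function.update T.par s' s⟩
  else if p < T.val s' then
    ⟨T.size, T.queue, Function.update T.val s' p, Function.update T.par s' s⟩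
  else T

section

variable (n m : ℕ) (R : ℕ → ℕ → Prop) [DecidableRel R]

/-- Try to add the job `v` to the configuration `s`. -/
def relax (s v : ℕ) (T : Tables) : Tables :=
  if Addable n R s v then T.record s (ext n s v) (nextPos n m R (s % n) v (T.val s)) else T

/-- Try to add each of the jobs `0, …, k - 1` to the configuration `s`. -/
def sweep (s : ℕ) (T : Tables) : ℕ → Tables
  | 0 => T
  | k + 1 => relax n m R s k (sweep s T k)

/-- The tables after `h` configurations have been taken from the queue. -/
def search : ℕ → Tables
  | 0 => ⟨1, 0, 0, 0⟩
  | h + 1 => sweep n m R ((search h).queue h) (search h) n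

end

/-! ### Encoding of configurations -/

theorem mem_jobs {n s u : ℕ} : u ∈ jobs n s ↔ (s / n).testBit u := by
  simp [jobs]

theorem sum_jobs (n s : ℕ) : ∑ u ∈ jobs n s, 2 ^ u = s / n :=
  sum_toFinset_bitIndices_two_pow _

@[simp] theorem jobs_zero (n : ℕ) : jobs n 0 = ∅ := by simp [jobs]

theorem ext_div {n s v : ℕ} (hv : v < n) : ext n s v / n = s / n + 2 ^ v := by
  rw [ext, mul_comm, Nat.mul_add_div (by omega), Nat.div_eq_of_lt hv, add_zero]

theorem ext_mod {n s v : ℕ} (hv : v < n) : ext n s v % n = v := by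
  rw [ext, mul_comm, Nat.mul_add_mod, Nat.mod_eq_of_lt hv]

/-- The start configuration is never reached again. It can therefore keep the value zero, which
everywhere else means "not found". -/
theorem ext_ne_zero {n s v : ℕ} (hv : v < n) : ext n s v ≠ 0 := by
  intro h
  have := ext_div (s := s) hv
  rw [h, Nat.zero_div] at this
  exact (Nat.add_pos_right _ (Nat.two_pow_pos v)).ne this

theorem jobs_ext {n s v : ℕ} (hv : v < n) (h : v ∉ jobs n s) :
    jobs n (ext n s v) = insert v (jobs n s) := by
  rw [jobs, ext_div hv, ← sum_jobs, add_comm, ← sum_insert h, toFinset_bitIndices_sum_two_pow]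

theorem eq_of_jobs_eq {n s s' : ℕ} (h : jobs n s = jobs n s') (h' : s % n = s' % n) : s = s' := by
  have : s / n = s' / n := by rw [← sum_jobs, h, sum_jobs]
  rw [← Nat.div_add_mod s n, ← Nat.div_add_mod s' n, h', this]

theorem div_lt_of_jobs_subset {n s : ℕ} (h : jobs n s ⊆ range n) : s / n < 2 ^ n := by
  rw [← sum_jobs]
  exact Nat.geomSum_lt le_rfl fun k hk => mem_range.1 (h hk)

/-! ### Slots and positions -/

theorem slot_mono {m p q : ℕ} (h : p ≤ q) : slot m p ≤ slot m q :=
  Nat.div_le_div_right (by omega)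

theorem slot_mul_add {m k c : ℕ} (hm : 1 ≤ m) (h1 : 1 ≤ c) (hc : c ≤ m) :
    slot m (m * k + c) = k + 1 := by
  rw [slot, show m * k + c + m - 1 = m * (k + 1) + (c - 1) by rw [mul_add]; omega,
    Nat.mul_add_div (by omega), Nat.div_eq_of_lt (by omega), add_zero]

/-- `slot m` is division by `m` rounded up, hence lower adjoint to multiplication by `m`. -/
theorem slot_le_iff {m p k : ℕ} (hm : 1 ≤ m) : slot m p ≤ k ↔ p ≤ m * k := by
  rw [slot, ← Nat.lt_succ_iff, Nat.div_lt_iff_lt_mul (by omega), Nat.succ_mul, mul_comm k]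
  omega

theorem le_mul_slot {m p : ℕ} (hm : 1 ≤ m) : p ≤ m * slot m p := (slot_le_iff hm).1 le_rfl

section

variable {n m : ℕ} {R : ℕ → ℕ → Prop} [DecidableRel R]

/-- Makes the positions along a chain of extensions distinct and positive. -/
theorem lt_nextPos (hm : 1 ≤ m) (l v p : ℕ) : p < nextPos n m R l v p := by
  have := le_mul_slot (p := p) hm
  unfold nextPos
  split <;> omega

/-- An earlier last job never delays the next one, so lowering a table entry cannot spoil the
estimates for the entries derived from it. -/
theorem nextPos_mono (l v : ℕ) {p q : ℕ} (h : p ≤ q) :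
    nextPos n m R l v p ≤ nextPos n m R l v q := by
  have := Nat.mul_le_mul_left m (slot_mono (m := m) h)
  unfold nextPos
  split <;> omega

/-- At worst the rest of the current slot is wasted, so each job costs at most one slot. This yields
`val_le` in the invariant. -/
theorem nextPos_le (hm : 1 ≤ m) {l v p c : ℕ} (h : p ≤ m * c) :
    nextPos n m R l v p ≤ m * (c + 1) := by
  have := Nat.mul_le_mul_left m ((slot_le_iff hm).2 h)
  rw [mul_add]
  unfold nextPos
  split <;> omega

theorem slot_lt_slot_nextPos (hm : 1 ≤ m) {l v p : ℕ} (h : rank n R l < rank n R v) :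
    slot m p < slot m (nextPos n m R l v p) := by
  rw [nextPos, if_pos h, slot_mul_add hm le_rfl hm]
  omega

end

/-! ### Invariants of the search -/

/-- `R` is a strict partial order on `0, …, n - 1`. -/
structure IsJobOrder (n : ℕ) (R : ℕ → ℕ → Prop) : Prop where
  lt_left : ∀ u v, R u v → u < n
  lt_right : ∀ u v, R u v → v < n
  irrefl : ∀ u, ¬ R u u
  trans : ∀ u v w, R u v → R v w → R u w

/-- By transitivity the predecessors of `u` are among those of `v`, and `u` itself is one more. -/
theorem IsJobOrder.rank_lt {n : ℕ} {R : ℕ → ℕ → Prop} [DecidableRel R] (hR : IsJobOrder n R)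
    {u v : ℕ} (h : R u v) : rank n R u < rank n R v := by
  refine card_lt_card ⟨fun w hw => ?_, fun H => ?_⟩
  · rw [mem_filter] at hw ⊢
    exact ⟨hw.1, hR.trans _ _ _ hw.2 h⟩
  · have := H (mem_filter.2 ⟨mem_range.2 (hR.lt_left _ _ h), h⟩)
    exact hR.irrefl _ (mem_filter.1 this).2

/-- The configuration `s` has been found. -/
def Tables.Found (T : Tables) (s : ℕ) : Prop := s = 0 ∨ T.val s ≠ 0

/-- The set of jobs is a lower set that contains the job added last. -/
structure IsConfig (n : ℕ) (R : ℕ → ℕ → Prop) (s : ℕ) : Prop where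
  subset : jobs n s ⊆ range n
  lower : ∀ u v, R u v → v ∈ jobs n s → u ∈ jobs n s
  last : s = 0 ∨ s % n ∈ jobs n s

theorem IsConfig.ext {n : ℕ} {R : ℕ → ℕ → Prop} (hR : IsJobOrder n R) {s v : ℕ} (hs : IsConfig n R s) (hv : v < n)
    (h : Addable n R s v) : IsConfig n R (ext n s v) := by
  refine ⟨?_, ?_, ?_⟩
  · rw [jobs_ext hv h.1, insert_subset_iff]
    exact ⟨mem_range.2 hv, hs.subset⟩
  · intro u w huw hw
    rw [jobs_ext hv h.1, mem_insert] at hw ⊢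
    rcases hw with rfl | hw
    · exact .inr (h.2 u (mem_range.2 (hR.lt_left _ _ huw)) huw)
    · exact .inr (hs.lower u w huw hw)
  · right
    rw [jobs_ext hv h.1, ext_mod hv]
    exact mem_insert_self _ _

/-- The invariant of the search when `h` configurations have been taken from the queue and for the
next one, `k` jobs have been tried. -/
structure SearchInv (n m : ℕ) (R : ℕ → ℕ → Prop) [DecidableRel R] (h k : ℕ) (T : Tables) :
    Prop where
  le_size : h ≤ T.size
  val_zero : T.val 0 = 0
  queue_zero : 0 < T.size ∧ T.queue 0 = 0
  found : ∀ i < T.size, T.Found (T.queue i)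
  exists_queue : ∀ s, T.Found s → ∃ i < T.size, T.queue i = s
  inj : ∀ i < T.size, ∀ j < T.size, T.queue i = T.queue j → i = j
  sorted : ∀ i j, i ≤ j → j < T.size → #(jobs n (T.queue i)) ≤ #(jobs n (T.queue j))
  spread : h < T.size → ∀ j < T.size, #(jobs n (T.queue j)) ≤ #(jobs n (T.queue h)) + 1
  config : ∀ s, T.Found s → IsConfig n R s
  val_le : ∀ s, T.val s ≤ m * #(jobs n s)
  par_found : ∀ s, T.val s ≠ 0 → T.Found (T.par s)
  par_addable : ∀ s, T.val s ≠ 0 → s % n < n ∧ Addable n R (T.par s) (s % n)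
  ext_par : ∀ s, T.val s ≠ 0 → ext n (T.par s) (s % n) = s
  nextPos_par_le : ∀ s, T.val s ≠ 0 →
    nextPos n m R (T.par s % n) (s % n) (T.val (T.par s)) ≤ T.val s
  complete : ∀ i v, (i < h ∧ v < n ∨ i = h ∧ v < k) → Addable n R (T.queue i) v →
    T.val (ext n (T.queue i) v) ≠ 0 ∧
    T.val (ext n (T.queue i) v) ≤ nextPos n m R (T.queue i % n) v (T.val (T.queue i))

section

variable {n m : ℕ} {R : ℕ → ℕ → Prop} [DecidableRel R]

theorem searchInv_init : SearchInv n m R 0 0 ⟨1, 0, 0, 0⟩ where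
  le_size := by simp
  val_zero := rfl
  queue_zero := by simp
  found := by simp [Tables.Found]
  exists_queue := by simp [Tables.Found]
  inj := by intro i hi j hj _; simp at hi hj; omega
  sorted := by simp
  spread := by simp
  config := by
    rintro s (rfl | h)
    · exact ⟨by simp, by simp, .inl rfl⟩
    · exact absurd rfl h
  val_le := by simp
  par_found := fun s h => absurd rfl h
  par_addable := fun s h => absurd rfl h
  ext_par := fun s h => absurd rfl h
  nextPos_par_le := fun s h => absurd rfl h
  complete := by intro i v h; omega

theorem SearchInv.next {h : ℕ} {T : Tables} (H : SearchInv n m R h n T) (hh : h < T.size) :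
    SearchInv n m R (h + 1) 0 T where
  le_size := hh
  val_zero := H.val_zero
  queue_zero := H.queue_zero
  found := H.found
  exists_queue := H.exists_queue
  inj := H.inj
  sorted := H.sorted
  spread := fun h1 j hj =>
    -- The next head of the queue has at least as many jobs as the old one, so the allowance of one
    -- extra job persists.
    (H.spread hh j hj).trans (Nat.add_le_add_right (H.sorted h (h + 1) (by omega) h1) 1)
  config := H.config
  val_le := H.val_le
  par_found := H.par_found
  par_addable := H.par_addable
  ext_par := H.ext_par
  nextPos_par_le := H.nextPos_par_le
  complete := fun i v hi => H.complete i v (by omega)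

/-- Recording the extension of the current configuration by a job preserves the invariant. -/
theorem SearchInv.record (hm : 1 ≤ m) (hR : IsJobOrder n R) {h k : ℕ} {T : Tables}
    (H : SearchInv n m R h k T) (hh : h < T.size) (hk : k < n)
    (ha : Addable n R (T.queue h) k) :
    SearchInv n m R h (k + 1) (T.record (T.queue h) (ext n (T.queue h) k)
      (nextPos n m R (T.queue h % n) k (T.val (T.queue h)))) := by
  obtain ⟨s, hs⟩ : ∃ s, T.queue h = s := ⟨_, rfl⟩
  obtain ⟨s', hs'⟩ : ∃ s', ext n s k = s' := ⟨_, rfl⟩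
  obtain ⟨p, hp⟩ : ∃ p, nextPos n m R (s % n) k (T.val s) = p := ⟨_, rfl⟩
  have hs0 : s' ≠ 0 := hs' ▸ ext_ne_zero hk
  have hsf : T.Found s := hs ▸ H.found h hh
  rw [hs] at ha
  have hjobs : jobs n s' = insert k (jobs n s) := hs' ▸ jobs_ext hk ha.1
  have hcard : #(jobs n s') = #(jobs n s) + 1 := by rw [hjobs, card_insert_of_notMem ha.1]
  have hmod : s' % n = k := hs' ▸ ext_mod hk
  have hne : s ≠ s' := by rintro rfl; omega
  have hp0 : p ≠ 0 := by have := lt_nextPos (n := n) (R := R) hm (s % n) k (T.val s); omega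
  have hple : p ≤ m * #(jobs n s') := by
    rw [hcard, ← hp]; exact nextPos_le hm (H.val_le s)
  have hconf : IsConfig n R s' := hs' ▸ (H.config s hsf).ext hR hk ha
  -- Entries up to `h` have at most as many jobs as `s`, and `s'` has one more. Hence an update at
  -- `s'` leaves all values from which extensions were computed unchanged.
  have hlow : ∀ i ≤ h, T.queue i ≠ s' := by
    rintro i hi rfl
    have := H.sorted i h hi hh
    rw [hs] at this
    omega
  rw [hs, hs', hp]
  -- the part common to both kinds of update
  have key : ∀ q : ℕ → ℕ, ∀ z : ℕ, T.size ≤ z → (∀ i < T.size, q i = T.queue i) →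
      (T.val s' = 0 ∨ p < T.val s') →
      let T' : Tables := ⟨z, q, Function.update T.val s' p, Function.update T.par s' s⟩
      (∀ x, T'.Found x ↔ x = s' ∨ T.Found x) →
      (∀ i < T'.size, T'.Found (T'.queue i)) →
      (∀ s, T'.Found s → ∃ i < T'.size, T'.queue i = s) →
      (∀ i < T'.size, ∀ j < T'.size, T'.queue i = T'.queue j → i = j) →
      (∀ i j, i ≤ j → j < T'.size → #(jobs n (T'.queue i)) ≤ #(jobs n (T'.queue j))) →
      (h < T'.size → ∀ j < T'.size, #(jobs n (T'.queue j)) ≤ #(jobs n (T'.queue h)) + 1) →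
      SearchInv n m R h (k + 1) T' := by
    intro q z hz hq hlt T' hF h1 h2 h3 h4 h5
    have hv : ∀ x, x ≠ s' → T'.val x = T.val x := fun x hx => Function.update_of_ne hx _ _
    have hpar : ∀ x, x ≠ s' → T'.par x = T.par x := fun x hx => Function.update_of_ne hx _ _
    have hvs : T'.val s' = p := Function.update_self ..
    have hps : T'.par s' = s := Function.update_self ..
    have hvle : ∀ x, T.val x ≠ 0 → T'.val x ≤ T.val x := by
      intro x hx
      by_cases hxs : x = s'
      · subst hxs; rw [hvs]; omega
      · rw [hv x hxs]
    have hval0 : ∀ x, T.val x ≠ 0 → T'.val x ≠ 0 := by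
      intro x hx
      by_cases hxs : x = s'
      · subst hxs; rwa [hvs]
      · rwa [hv x hxs]
    have hvle' : ∀ x, T.Found x → T'.val x ≤ T.val x := by
      rintro x (rfl | hx)
      · rw [hv 0 hs0.symm]
      · exact hvle x hx
    exact {
      le_size := H.le_size.trans hz
      val_zero := by rw [hv 0 hs0.symm, H.val_zero]
      queue_zero := ⟨H.queue_zero.1.trans_le hz, by
        change q 0 = 0
        rw [hq 0 H.queue_zero.1, H.queue_zero.2]⟩
      found := h1
      exists_queue := h2
      inj := h3
      sorted := h4
      spread := h5
      config := by
        intro x hx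
        rcases (hF x).1 hx with rfl | hx
        · exact hconf
        · exact H.config x hx
      val_le := by
        intro x
        by_cases hxs : x = s'
        · subst hxs; rwa [hvs]
        · rw [hv x hxs]; exact H.val_le x
      par_found := by
        intro x hx
        by_cases hxs : x = s'
        · subst hxs; rw [hps]; exact (hF s).2 (.inr hsf)
        · rw [hv x hxs] at hx
          rw [hpar x hxs]; exact (hF _).2 (.inr (H.par_found x hx))
      par_addable := by
        intro x hx
        by_cases hxs : x = s'
        · subst hxs; rw [hps, hmod]; exact ⟨hk, ha⟩
        · rw [hv x hxs] at hx
          rw [hpar x hxs]; exact H.par_addable x hx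
      ext_par := by
        intro x hx
        by_cases hxs : x = s'
        · subst hxs; rw [hps, hmod]; exact hs'
        · rw [hv x hxs] at hx
          rw [hpar x hxs]; exact H.ext_par x hx
      nextPos_par_le := by
        intro x hx
        by_cases hxs : x = s'
        · subst hxs; rw [hps, hmod, hv s hne, hvs, hp]
        · rw [hv x hxs] at hx ⊢
          rw [hpar x hxs]
          -- The value of the parent may have dropped, which monotonicity tolerates.
          exact (nextPos_mono _ _ (hvle' _ (H.par_found x hx))).trans (H.nextPos_par_le x hx)
      complete := by
        intro i v hi
        have hih : i ≤ h := by omega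
        change Addable n R (q i) v → T'.val (Sched.ext n (q i) v) ≠ 0 ∧
          T'.val (Sched.ext n (q i) v) ≤ nextPos n m R (q i % n) v (T'.val (q i))
        rw [hq i (by omega), hv _ (hlow i hih)]
        intro hav
        by_cases hik : i = h ∧ v = k
        · obtain ⟨rfl, rfl⟩ := hik
          rw [hs, hs', hvs, hp]
          exact ⟨hp0, le_rfl⟩
        · obtain ⟨h1, h2⟩ := H.complete i v (by omega) hav
          exact ⟨hval0 _ h1, (hvle _ h1).trans h2⟩ }
  unfold Tables.record
  split_ifs with c1 c2
  · have hq : ∀ i < T.size, Function.update T.queue T.size s' i = T.queue i := fun i hi =>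
      Function.update_of_ne hi.ne _ _
    have hqs : Function.update T.queue T.size s' T.size = s' := Function.update_self ..
    have hF : ∀ x, (Tables.mk (T.size + 1) (Function.update T.queue T.size s')
        (Function.update T.val s' p) (Function.update T.par s' s)).Found x ↔
          x = s' ∨ T.Found x := by
      intro x
      by_cases hxs : x = s'
      · simp [Tables.Found, hxs, hp0]
      · simp [Tables.Found, hxs]
    have hnf : ¬ T.Found s' := by simp [Tables.Found, hs0, c1]
    refine key _ _ (by omega) hq (.inl c1) hF ?_ ?_ ?_ ?_ ?_
    · intro i hi
      rw [hF]
      rcases Nat.lt_succ_iff_lt_or_eq.1 hi with hi | rfl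
      · simp only [hq i hi]; exact .inr (H.found i hi)
      · exact .inl hqs
    · intro x hx
      rcases (hF x).1 hx with rfl | hx
      · exact ⟨T.size, by simp, hqs⟩
      · obtain ⟨i, hi, rfl⟩ := H.exists_queue x hx
        exact ⟨i, by simp; omega, hq i hi⟩
    · intro i hi j hj hij
      rcases Nat.lt_succ_iff_lt_or_eq.1 hi with hi | rfl <;>
        rcases Nat.lt_succ_iff_lt_or_eq.1 hj with hj | rfl
      · simp only [hq i hi, hq j hj] at hij; exact H.inj i hi j hj hij
      · simp only [hq i hi, hqs] at hij; exact absurd (hij ▸ H.found i hi) hnf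
      · simp only [hq j hj, hqs] at hij; exact absurd (hij ▸ H.found j hj) hnf
      · rfl
    · intro i j hij hj
      rcases Nat.lt_succ_iff_lt_or_eq.1 hj with hj | rfl
      · simp only [hq i (by omega), hq j hj]; exact H.sorted i j hij hj
      -- Appending `s'` keeps the queue sorted: by `spread`, no entry has more than one job beyond
      -- the head, and `s'` has exactly one more.
      · rcases hij.lt_or_eq with hi | rfl
        · simp only [hq i hi, hqs]
          rw [hcard, ← hs]; exact H.spread hh i hi
        · rfl
    · intro _ j hj
      simp only [hq h hh]
      rcases Nat.lt_succ_iff_lt_or_eq.1 hj with hj | rfl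
      · simp only [hq j hj]; exact H.spread hh j hj
      · simp only [hqs]; rw [hcard, hs]
  · have hF : ∀ x, (Tables.mk T.size T.queue
        (Function.update T.val s' p) (Function.update T.par s' s)).Found x ↔
          x = s' ∨ T.Found x := by
      intro x
      by_cases hxs : x = s'
      · simp [Tables.Found, hxs, hp0]
      · simp [Tables.Found, hxs]
    have hF' : ∀ x, (x = s' ∨ T.Found x) ↔ T.Found x := by
      intro x
      refine ⟨?_, .inr⟩
      rintro (rfl | hx)
      · exact .inr c1
      · exact hx
    exact key _ _ le_rfl (fun _ _ => rfl) (.inr c2) hF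
      (fun i hi => (hF _).2 (.inr (H.found i hi)))
      (fun x hx => H.exists_queue x ((hF' x).1 ((hF x).1 hx))) H.inj H.sorted H.spread
  · exact { H with
      complete := by
        intro i v hi hav
        by_cases hik : i = h ∧ v = k
        · obtain ⟨rfl, rfl⟩ := hik
          rw [hs, hs', hp]
          exact ⟨c1, by omega⟩
        · exact H.complete i v (by omega) hav }

theorem SearchInv.relax (hm : 1 ≤ m) (hR : IsJobOrder n R) {h k : ℕ} {T : Tables}
    (H : SearchInv n m R h k T) (hh : h < T.size) (hk : k < n) :
    SearchInv n m R h (k + 1) (relax n m R (T.queue h) k T) := by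
  unfold Sched.relax
  split_ifs with ha
  · exact H.record hm hR hh hk ha
  · exact { H with
      complete := by
        intro i v hi hav
        by_cases hik : i = h ∧ v = k
        · obtain ⟨rfl, rfl⟩ := hik
          exact absurd hav ha
        · exact H.complete i v (by omega) hav }

theorem Tables.le_record_size (T : Tables) (s s' p : ℕ) : T.size ≤ (T.record s s' p).size := by
  unfold Tables.record; split_ifs <;> simp

theorem Tables.record_queue (T : Tables) (s s' p : ℕ) {i : ℕ} (hi : i < T.size) :
    (T.record s s' p).queue i = T.queue i := by
  unfold Tables.record; split_ifs <;> simp [Function.update_of_ne hi.ne]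

theorem le_relax_size (s v : ℕ) (T : Tables) : T.size ≤ (relax n m R s v T).size := by
  unfold relax; split_ifs
  · exact T.le_record_size _ _ _
  · exact le_rfl

theorem relax_queue (s v : ℕ) (T : Tables) {i : ℕ} (hi : i < T.size) :
    (relax n m R s v T).queue i = T.queue i := by
  unfold relax; split_ifs
  · exact T.record_queue _ _ _ hi
  · rfl

theorem SearchInv.sweep (hm : 1 ≤ m) (hR : IsJobOrder n R) {h : ℕ} {T : Tables}
    (H : SearchInv n m R h 0 T) (hh : h < T.size) {k : ℕ} (hk : k ≤ n) :
    SearchInv n m R h k (sweep n m R (T.queue h) T k) ∧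
      h < (sweep n m R (T.queue h) T k).size ∧
      (sweep n m R (T.queue h) T k).queue h = T.queue h := by
  induction k with
  | zero => exact ⟨H, hh, rfl⟩
  | succ k ih =>
    obtain ⟨h1, h2, h3⟩ := ih (by omega)
    refine ⟨?_, h2.trans_le (le_relax_size _ _ _), ?_⟩
    · have := h1.relax hm hR h2 (by omega)
      rwa [h3] at this
    · rw [Sched.sweep, relax_queue _ _ _ h2, h3]

theorem SearchInv.search_succ (hm : 1 ≤ m) (hR : IsJobOrder n R) {h : ℕ}
    (H : SearchInv n m R h 0 (search n m R h)) (hh : h < (search n m R h).size) :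
    SearchInv n m R (h + 1) 0 (search n m R (h + 1)) := by
  obtain ⟨h1, h2, -⟩ := H.sweep hm hR hh le_rfl
  exact h1.next h2

/-! ### Reading off a schedule -/

/-- Follow the predecessors for at most `k` steps, recording the slot of each job. -/
def traceBack (n m : ℕ) (T : Tables) : ℕ → ℕ → (ℕ → ℕ) → ℕ → ℕ
  | 0, _, f => f
  | k + 1, s, f => if T.val s = 0 then f
      else traceBack n m T k (T.par s) (Function.update f (s % n) (slot m (T.val s)))

/-- A schedule of the jobs of configuration `s`, by positions. -/
structure IsPlan (n m : ℕ) (R : ℕ → ℕ → Prop) [DecidableRel R] (T : Tables) (s : ℕ)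
    (pos : ℕ → ℕ) : Prop where
  pos_le : ∀ u ∈ jobs n s, pos u ≤ T.val s
  one_le : ∀ u ∈ jobs n s, 1 ≤ pos u
  inj : ∀ u ∈ jobs n s, ∀ w ∈ jobs n s, pos u = pos w → u = w
  lt : ∀ u ∈ jobs n s, ∀ w ∈ jobs n s, R u w → slot m (pos u) < slot m (pos w)
  rank_le : ∀ u ∈ jobs n s, slot m (pos u) < slot m (T.val s) ∨ rank n R (s % n) ≤ rank n R u

/-- Induction along the parent pointers, undoing the last extension. The invariant that carries it
is `rank_le`: every job in the slot of the last job has at least its rank. A predecessor of the last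
job has smaller rank, so it lies in an earlier slot. -/
theorem SearchInv.exists_plan (hm : 1 ≤ m) (hR : IsJobOrder n R) {h k : ℕ} {T : Tables}
    (H : SearchInv n m R h k T) {c s : ℕ} (hc : #(jobs n s) = c) (hs : T.Found s) :
    ∃ pos, IsPlan n m R T s pos ∧
      ∀ f u, traceBack n m T c s f u = if u ∈ jobs n s then slot m (pos u) else f u := by
  induction c generalizing s with
  | zero =>
    have : jobs n s = ∅ := card_eq_zero.1 hc
    exact ⟨0, ⟨by simp [this], by simp [this], by simp [this], by simp [this], by simp [this]⟩,
      by simp [traceBack, this]⟩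
  | succ c ih =>
    have hv : T.val s ≠ 0 := by
      rcases hs with rfl | hs
      · simp at hc
      · exact hs
    obtain ⟨hvn, ha⟩ := H.par_addable s hv
    have hex := H.ext_par s hv
    have hnp := H.nextPos_par_le s hv
    have hpf := H.par_found s hv
    obtain ⟨s₀, hs₀⟩ : ∃ s₀, T.par s = s₀ := ⟨_, rfl⟩
    obtain ⟨v, hv'⟩ : ∃ v, s % n = v := ⟨_, rfl⟩
    rw [hs₀, hv'] at ha hex hnp
    rw [hv'] at hvn
    rw [hs₀] at hpf
    have hj : jobs n s = insert v (jobs n s₀) := by rw [← hex, jobs_ext hvn ha.1]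
    have hc₀ : #(jobs n s₀) = c := by
      rw [hj, card_insert_of_notMem ha.1] at hc; omega
    obtain ⟨pos, hpos, htr⟩ := ih hc₀ hpf
    have hlt : T.val s₀ < T.val s := (lt_nextPos hm _ _ _).trans_le hnp
    have hslot := slot_mono (m := m) hlt.le
    -- If `v` has larger rank than the previous last job, a new slot is opened and all old jobs lie
    -- before it. Otherwise the bound for the previous last job passes on to `v`.
    have hrk : ∀ u ∈ jobs n s₀, slot m (pos u) < slot m (T.val s) ∨ rank n R v ≤ rank n R u := by
      intro u hu
      have h1 := slot_mono (m := m) (hpos.pos_le u hu)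
      rcases hpos.rank_le u hu with h2 | h2
      · left; omega
      · by_cases h3 : rank n R (s₀ % n) < rank n R v
        · left
          have h4 := slot_lt_slot_nextPos (p := T.val s₀) hm h3
          have h5 := slot_mono (m := m) hnp
          omega
        · right; omega
    have hu' : ∀ u ∈ jobs n s₀, Function.update pos v (T.val s) u = pos u := fun u hu =>
      Function.update_of_ne (by rintro rfl; exact ha.1 hu) _ _
    have hv'' : Function.update pos v (T.val s) v = T.val s := Function.update_self ..
    refine ⟨Function.update pos v (T.val s), ⟨?_, ?_, ?_, ?_, ?_⟩, ?_⟩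
    · rw [hj, forall_mem_insert, hv'']
      exact ⟨le_rfl, fun u hu => by rw [hu' u hu]; exact (hpos.pos_le u hu).trans hlt.le⟩
    · rw [hj, forall_mem_insert, hv'']
      exact ⟨by omega, fun u hu => by rw [hu' u hu]; exact hpos.one_le u hu⟩
    · rw [hj, forall_mem_insert, forall_mem_insert]
      refine ⟨⟨fun _ => rfl, fun w hw h => ?_⟩, fun u hu => ?_⟩
      · rw [hv'', hu' w hw] at h
        have := hpos.pos_le w hw
        omega
      · rw [forall_mem_insert]
        refine ⟨fun h => ?_, fun w hw h => ?_⟩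
        · rw [hv'', hu' u hu] at h
          have := hpos.pos_le u hu
          omega
        · rw [hu' u hu, hu' w hw] at h
          exact hpos.inj u hu w hw h
    · rw [hj, forall_mem_insert, forall_mem_insert]
      refine ⟨⟨fun h => absurd h (hR.irrefl v), fun w hw h => ?_⟩, fun u hu => ?_⟩
      · exact absurd ((H.config s₀ hpf).lower v w h hw) ha.1
      · rw [forall_mem_insert]
        refine ⟨fun h => ?_, fun w hw h => ?_⟩
        · rw [hv'', hu' u hu]
          have := hR.rank_lt h
          rcases hrk u hu with h1 | h1
          · exact h1
          · omega
        · rw [hu' u hu, hu' w hw]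
          exact hpos.lt u hu w hw h
    · rw [hj, forall_mem_insert, hv'', hv']
      exact ⟨.inr le_rfl, fun u hu => by rw [hu' u hu]; exact hrk u hu⟩
    · intro f u
      rw [traceBack, if_neg hv, hs₀, hv', htr, hj]
      by_cases hu : u ∈ jobs n s₀
      · rw [if_pos hu, if_pos (mem_insert_of_mem hu), hu' u hu]
      · rw [if_neg hu]
        by_cases huv : u = v
        · subst huv; simp
        · simp [huv, hu]

/-! ### Optimality -/

/-- When the queue is exhausted, every schedule is dominated by a configuration that was found. -/
theorem SearchInv.exists_le (hm : 1 ≤ m) (hR : IsJobOrder n R) {T : Tables}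
    (H : SearchInv n m R T.size 0 T) {σ : ℕ → ℕ} (h1 : ∀ u < n, 1 ≤ σ u)
    (hcard : ∀ t, #{u ∈ range n | σ u = t} ≤ m) (hlt : ∀ u v, R u v → σ u < σ v)
    (hn : 0 < n) :
    ∃ s, T.Found s ∧ jobs n s = range n ∧ s % n < n ∧ T.val s ≤ m * σ (s % n) := by
  have hrn : ∀ v, rank n R v ≤ n := fun v => (card_filter_le _ _).trans (by simp)
  -- Lexicographic key: first the slot, then decreasing rank; the second part is at most `n`, hence
  -- the factor `n + 1`.
  let κ : ℕ → ℕ := fun v => σ v * (n + 1) + (n - rank n R v)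
  have hκ : ∀ u v, σ u < σ v → κ u < κ v := by
    intro u v h
    have : (σ u + 1) * (n + 1) ≤ σ v * (n + 1) := Nat.mul_le_mul_right _ h
    rw [add_mul] at this
    simp only [κ]
    omega
  -- The lower sets are built up in order of `κ`, the last job being one of largest key. The value
  -- is bounded by the full slots before it plus the jobs of `S` in its own slot.
  suffices key : ∀ S : Finset ℕ, S ⊆ range n → (∀ u v, R u v → v ∈ S → u ∈ S) → S.Nonempty →
      ∃ s, T.Found s ∧ jobs n s = S ∧ s % n ∈ S ∧ (∀ u ∈ S, κ u ≤ κ (s % n)) ∧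
        T.val s ≤ m * (σ (s % n) - 1) + #{u ∈ S | σ u = σ (s % n)} by
    obtain ⟨s, h2, h3, h4, -, h5⟩ := key (range n) subset_rfl
      (fun u v h _ => mem_range.2 (hR.lt_left u v h)) ⟨0, mem_range.2 hn⟩
    refine ⟨s, h2, h3, mem_range.1 h4, h5.trans ?_⟩
    have := h1 _ (mem_range.1 h4)
    obtain ⟨c, hc⟩ : ∃ c, σ (s % n) = c + 1 := ⟨σ (s % n) - 1, by omega⟩
    have := hcard (σ (s % n))
    rw [hc] at this ⊢
    rw [mul_add]
    simp only [Nat.add_sub_cancel]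
    omega
  intro S
  induction S using Finset.induction_on_max_value κ with
  | empty => intro _ _ h; exact absurd h (by simp)
  | insert a S ha hmax ih =>
    intro hsub hlow _
    rw [insert_subset_iff, mem_range] at hsub
    -- Removing a job of maximal key leaves a lower set, because keys increase along `R`.
    have hlow' : ∀ u v, R u v → v ∈ S → u ∈ S := by
      intro u v h hv
      rcases mem_insert.1 (hlow u v h (mem_insert_of_mem hv)) with rfl | hu
      · have := hκ _ _ (hlt _ _ h)
        have := hmax v hv
        omega
      · exact hu
    have hadd : ∀ s, jobs n s = S → Addable n R s a := by
      intro s hs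
      rw [Addable, hs]
      refine ⟨ha, fun u _ h => ?_⟩
      rcases mem_insert.1 (hlow u a h (mem_insert_self _ _)) with rfl | hu
      · exact absurd h (hR.irrefl _)
      · exact hu
    have main : ∀ s, T.Found s → jobs n s = S →
        nextPos n m R (s % n) a (T.val s) ≤
          m * (σ a - 1) + #{u ∈ insert a S | σ u = σ a} →
        ∃ s, T.Found s ∧ jobs n s = insert a S ∧ s % n ∈ insert a S ∧
          (∀ u ∈ insert a S, κ u ≤ κ (s % n)) ∧
          T.val s ≤ m * (σ (s % n) - 1) + #{u ∈ insert a S | σ u = σ (s % n)} := by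
      intro s hs hj hle
      obtain ⟨i, hi, rfl⟩ := H.exists_queue s hs
      obtain ⟨h2, h3⟩ := H.complete i a (.inl ⟨hi, hsub.1⟩) (hadd _ hj)
      refine ⟨ext n (T.queue i) a, .inr h2, ?_⟩
      rw [jobs_ext hsub.1 (hadd _ hj).1, ext_mod hsub.1, hj]
      refine ⟨rfl, mem_insert_self _ _, ?_, h3.trans hle⟩
      rw [forall_mem_insert]
      exact ⟨le_rfl, hmax⟩
    have hpos : 1 ≤ #{u ∈ insert a S | σ u = σ a} :=
      card_pos.2 ⟨a, mem_filter.2 ⟨mem_insert_self _ _, rfl⟩⟩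
    rcases S.eq_empty_or_nonempty with rfl | hne
    · refine main 0 (.inl rfl) (by simp) ?_
      rw [H.val_zero]
      have : nextPos n m R (0 % n) a 0 ≤ 1 := by
        unfold nextPos
        split_ifs
        · rw [show slot m 0 = 0 from Nat.le_zero.1 ((slot_le_iff hm).2 (by simp))]; simp
        · simp
      omega
    · obtain ⟨s, h2, h3, h4, h5, h6⟩ := ih hsub.2 hlow' hne
      refine main s h2 h3 ?_
      obtain ⟨l, hl⟩ : ∃ l, s % n = l := ⟨_, rfl⟩
      rw [hl] at h4 h5 h6 ⊢
      have hln : l < n := mem_range.1 (hsub.2 h4)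
      have hσl := h1 l hln
      have hσ : σ l ≤ σ a := by
        by_contra hc
        have := hκ a l (by omega)
        have := hmax l h4
        omega
      have hbd : T.val s ≤ m * σ l := by
        obtain ⟨c, hc⟩ : ∃ c, σ l = c + 1 := ⟨σ l - 1, by omega⟩
        have : #{u ∈ S | σ u = σ l} ≤ m :=
          (card_le_card (filter_subset_filter _ hsub.2)).trans (hcard _)
        rw [hc] at h6 this ⊢
        rw [mul_add]
        simp only [Nat.add_sub_cancel] at h6
        omega
      -- If the schedule moves to a later slot, opening a slot is harmless. If it stays in the slot,
      -- the order of keys says that the rank does not increase, so only one position is used.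
      rcases hσ.lt_or_eq with hσ | hσ
      · have h7 : nextPos n m R l a (T.val s) ≤ m * σ l + 1 := by
          have := Nat.mul_le_mul_left m ((slot_le_iff hm).2 hbd)
          unfold nextPos
          split_ifs <;> omega
        have := Nat.mul_le_mul_left m (show σ l ≤ σ a - 1 by omega)
        omega
      · have hr : ¬ rank n R l < rank n R a := by
          have := hmax l h4
          simp only [κ, hσ] at this
          have := hrn l
          have := hrn a
          omega
        rw [nextPos, if_neg hr, filter_insert, if_pos rfl,
          card_insert_of_notMem (by simp [ha]), ← hσ]
        omega

end

end Sched

/-! ### The program -/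

namespace RAM

instance : Add Expr := ⟨.op .add⟩
instance : Sub Expr := ⟨.op .sub⟩
instance : Mul Expr := ⟨.op .mul⟩
instance : Div Expr := ⟨.op .div⟩
instance (c : ℕ) : OfNat Expr c := ⟨.const c⟩

@[simp] theorem Expr.eval_add (s : State) (a b : Expr) : (a + b).eval s = a.eval s + b.eval s := rfl
@[simp] theorem Expr.eval_sub (s : State) (a b : Expr) : (a - b).eval s = a.eval s - b.eval s := rfl
@[simp] theorem Expr.eval_mul (s : State) (a b : Expr) : (a * b).eval s = a.eval s * b.eval s := rfl
@[simp] theorem Expr.eval_div (s : State) (a b : Expr) : (a / b).eval s = a.eval s / b.eval s := rfl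
@[simp] theorem Expr.eval_reg (s : State) (i : ℕ) : (Expr.reg i).eval s = s.reg i := rfl
@[simp] theorem Expr.eval_load (s : State) (a : Expr) : (Expr.load a).eval s = s.mem (a.eval s) :=
  rfl
@[simp] theorem Expr.eval_zero (s : State) : Expr.eval s 0 = 0 := rfl
@[simp] theorem Expr.eval_one (s : State) : Expr.eval s 1 = 1 := rfl
@[simp] theorem Expr.eval_two (s : State) : Expr.eval s 2 = 2 := rfl
@[simp] theorem Expr.eval_three (s : State) : Expr.eval s 3 = 3 := rfl

@[simp] theorem Cmd.sim_seq (c d : Cmd) (s : State) : (Cmd.seq c d).sim s = d.sim (c.sim s) := rfl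
@[simp] theorem Cmd.sim_skip (s : State) : Cmd.skip.sim s = s := rfl
@[simp] theorem Cmd.sim_assign (i : ℕ) (e : Expr) (s : State) :
    (Cmd.assign i e).sim s = ⟨Function.update s.reg i (e.eval s), s.mem⟩ := rfl
@[simp] theorem Cmd.sim_store (a e : Expr) (s : State) :
    (Cmd.store a e).sim s = ⟨s.reg, Function.update s.mem (a.eval s) (e.eval s)⟩ := rfl
@[simp] theorem Cmd.sim_ite (e : Expr) (c d : Cmd) (s : State) :
    (Cmd.ite e c d).sim s = if e.eval s ≠ 0 then c.sim s else d.sim s := rfl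

end RAM

namespace Sched

open Finset RAM

/-- The addresses of the entries of the three tables; register `0` holds `n`. -/
def queueAddr (i : Expr) : Expr := .reg 0 * .reg 0 + 3 * i
def valAddr (s : Expr) : Expr := .reg 0 * .reg 0 + (3 * s + 1)
def parAddr (s : Expr) : Expr := .reg 0 * .reg 0 + (3 * s + 2)
def valAt (s : Expr) : Expr := .load (valAddr s)

/-- The slot of a position; register `1` holds `m`. -/
def slotExpr (p : Expr) : Expr := (p + .reg 1 - 1) / .reg 1

def matrixAt (u v : Expr) : Expr := .load (u * .reg 0 + v)

/-- Job `u` (register `8`) is examined as a predecessor of `v` (register `7`). The lowest bit of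
register `9` tells whether `u` has been scheduled; register `10` counts obstructions to adding `v`;
registers `11` and `12` count the predecessors of `v` and of the job added last (register `6`), and
register `13` runs through the powers of two up to `2 ^ v`. -/
def scanBody : Cmd :=
  .seq (.assign 16 (.reg 9 - 2 * (.reg 9 / 2))) <|
  .seq (.assign 10 (.reg 10 + (matrixAt (.reg 8) (.reg 7) * (1 - .reg 16) +
    .reg 16 * ((1 - (.reg 8 - .reg 7)) * (1 - (.reg 7 - .reg 8)))))) <|
  .seq (.assign 11 (.reg 11 + matrixAt (.reg 8) (.reg 7))) <|
  .seq (.assign 12 (.reg 12 + matrixAt (.reg 8) (.reg 6))) <|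
  .seq (.assign 13 (.reg 13 + .reg 13 * (1 - (1 - (.reg 7 - .reg 8))))) <|
  .seq (.assign 9 (.reg 9 / 2)) <|
  .assign 8 (.reg 8 + 1)

def scanInit : Cmd :=
  .seq (.assign 8 0) <| .seq (.assign 9 (.reg 5)) <| .seq (.assign 10 0) <|
  .seq (.assign 11 0) <| .seq (.assign 12 0) <| .assign 13 1

/-- Compute the position and the configuration reached by adding `v`, after the scan. -/
def positionCmd : Cmd :=
  .seq (.ite (.reg 11 - .reg 12) (.assign 14 (.reg 1 * slotExpr (valAt (.reg 4)) + 1))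
    (.assign 14 (valAt (.reg 4) + 1))) <|
  .assign 15 ((.reg 5 + .reg 13) * .reg 0 + .reg 7)

/-- Machine form of `Tables.record`. Since zero means "not found", the initially zero memory needs
no preparation. -/
def recordCmd : Cmd :=
  .ite (valAt (.reg 15))
    (.ite (valAt (.reg 15) - .reg 14)
      (.seq (.store (valAddr (.reg 15)) (.reg 14)) (.store (parAddr (.reg 15)) (.reg 4)))
      .skip)
    (.seq (.store (queueAddr (.reg 3)) (.reg 15)) <|
     .seq (.store (valAddr (.reg 15)) (.reg 14)) <|
     .seq (.store (parAddr (.reg 15)) (.reg 4)) <|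
     .assign 3 (.reg 3 + 1))

def relaxCmd : Cmd := .ite (.reg 10) .skip (.seq positionCmd recordCmd)

def sweepBody : Cmd :=
  .seq scanInit <| .seq (.while (.reg 0 - .reg 8) scanBody) <|
  .seq relaxCmd (.assign 7 (.reg 7 + 1))

def sweepInit : Cmd :=
  .seq (.assign 4 (.load (queueAddr (.reg 2)))) <| .seq (.assign 5 (.reg 4 / .reg 0)) <|
  .seq (.assign 6 (.reg 4 - .reg 5 * .reg 0)) <| .assign 7 0

def searchBody : Cmd :=
  .seq sweepInit <| .seq (.while (.reg 0 - .reg 7) sweepBody) <| .assign 2 (.reg 2 + 1)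

/-- Registers `2` and `3` are the head and the length of the queue. Its first entry, the start
configuration `0`, is already in memory. -/
def searchCmd : Cmd := .seq (.assign 3 1) (.while (.reg 3 - .reg 2) searchBody)

/-- The search leaves the last queue entry in register `4` and its mask in register `5`. That mask
contains all jobs, so only the last job remains to be chosen. -/
def bestInit : Cmd :=
  .seq (.assign 8 (.reg 4)) <| .seq (.assign 14 (valAt (.reg 8))) <| .assign 7 0

/-- The product in the test is nonzero exactly when the candidate was found and is strictly better.
-/
def bestBody : Cmd :=
  .seq (.assign 15 (.reg 5 * .reg 0 + .reg 7)) <|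
  .seq (.ite (valAt (.reg 15) * (.reg 14 - valAt (.reg 15)))
    (.seq (.assign 8 (.reg 15)) (.assign 14 (valAt (.reg 15)))) .skip) <|
  .assign 7 (.reg 7 + 1)

def bestCmd : Cmd := .seq bestInit (.while (.reg 0 - .reg 7) bestBody)

/-- The slots overwrite the first cells of the adjacency matrix, which is no longer needed. -/
def traceBody : Cmd :=
  .seq (.store (.reg 8 - .reg 8 / .reg 0 * .reg 0) (slotExpr (valAt (.reg 8)))) <|
  .assign 8 (.load (parAddr (.reg 8)))

def traceCmd : Cmd := .while (valAt (.reg 8)) traceBody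

/-- The whole program. -/
def scheduler : Cmd :=
  .seq searchCmd <| .seq bestCmd <| .seq traceCmd <| .assign 0 (slotExpr (.reg 14))

/-! ### Layout of the memory -/

/-- The memory: the cells below `n * n` are given by `f`, the tables are interleaved above. -/
def layout (n : ℕ) (f : ℕ → ℕ) (T : Tables) (a : ℕ) : ℕ :=
  if a < n * n then f a
  else if (a - n * n) % 3 = 0 then T.queue ((a - n * n) / 3)
  else if (a - n * n) % 3 = 1 then T.val ((a - n * n) / 3)
  else T.par ((a - n * n) / 3)

section

variable (n : ℕ) (f : ℕ → ℕ) (T : Tables)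

theorem layout_low {a : ℕ} (h : a < n * n) : layout n f T a = f a := if_pos h

theorem layout_queue (i : ℕ) : layout n f T (n * n + 3 * i) = T.queue i := by
  rw [layout, if_neg (by omega), if_pos (by omega)]
  congr 1; omega

theorem layout_val (i : ℕ) : layout n f T (n * n + (3 * i + 1)) = T.val i := by
  rw [layout, if_neg (by omega), if_neg (by omega), if_pos (by omega)]
  congr 1; omega

theorem layout_par (i : ℕ) : layout n f T (n * n + (3 * i + 2)) = T.par i := by
  rw [layout, if_neg (by omega), if_neg (by omega), if_neg (by omega)]
  congr 1; omega

theorem update_layout_low {a : ℕ} (h : a < n * n) (x : ℕ) :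
    Function.update (layout n f T) a x = layout n (Function.update f a x) T := by
  funext b
  by_cases hb : b = a
  · subst hb; rw [Function.update_self, layout_low _ _ _ h, Function.update_self]
  · rw [Function.update_of_ne hb]; simp only [layout, Function.update_of_ne hb]

theorem update_layout_queue (i x : ℕ) : Function.update (layout n f T) (n * n + 3 * i) x =
    layout n f ⟨T.size, Function.update T.queue i x, T.val, T.par⟩ := by
  funext b
  by_cases hb : b = n * n + 3 * i
  · subst hb; rw [Function.update_self, layout_queue]; simp
  · rw [Function.update_of_ne hb]
    simp only [layout]
    split_ifs <;> first | rfl | (rw [Function.update_of_ne]; omega)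

theorem update_layout_val (i x : ℕ) : Function.update (layout n f T) (n * n + (3 * i + 1)) x =
    layout n f ⟨T.size, T.queue, Function.update T.val i x, T.par⟩ := by
  funext b
  by_cases hb : b = n * n + (3 * i + 1)
  · subst hb; rw [Function.update_self, layout_val]; simp
  · rw [Function.update_of_ne hb]
    simp only [layout]
    split_ifs <;> first | rfl | (rw [Function.update_of_ne]; omega)

theorem update_layout_par (i x : ℕ) : Function.update (layout n f T) (n * n + (3 * i + 2)) x =
    layout n f ⟨T.size, T.queue, T.val, Function.update T.par i x⟩ := by
  funext b
  by_cases hb : b = n * n + (3 * i + 2)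
  · subst hb; rw [Function.update_self, layout_par]; simp
  · rw [Function.update_of_ne hb]
    simp only [layout]
    split_ifs <;> first | rfl | (rw [Function.update_of_ne]; omega)

end

/-- The adjacency matrix, by rows. -/
def matrix (n : ℕ) (R : ℕ → ℕ → Prop) [DecidableRel R] (a : ℕ) : ℕ :=
  if R (a / n) (a % n) then 1 else 0

theorem layout_matrix (n : ℕ) (R : ℕ → ℕ → Prop) [DecidableRel R] (T : Tables) {u v : ℕ}
    (hu : u < n) (hv : v < n) :
    layout n (matrix n R) T (u * n + v) = if R u v then 1 else 0 := by
  have h : u * n + v < n * n := by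
    have := Nat.mul_le_mul_right n (show u + 1 ≤ n from hu)
    rw [add_mul] at this
    omega
  rw [layout_low _ _ _ h, matrix, mul_comm, Nat.mul_add_div (by omega), Nat.div_eq_of_lt hv,
    add_zero, Nat.mul_add_mod, Nat.mod_eq_of_lt hv]

/-! ### Correctness of the search loop -/

/-- The numbers that have to fit into a machine word. -/
structure Fitting (n m A M : ℕ) : Prop where
  states : 2 ^ n * (n + 1) ≤ M
  positions : m * (n + 1) ≤ M
  size : A ≤ M

theorem Fitting.le_left {n m A M : ℕ} (h : Fitting n m A M) : n + 1 ≤ M :=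
  (Nat.le_mul_of_pos_left _ (by positivity)).trans h.states

theorem Fitting.two_pow_le {n m A M : ℕ} (h : Fitting n m A M) : 2 ^ n ≤ M :=
  (Nat.le_mul_of_pos_right _ (by positivity)).trans h.states

/-- The contents of memory and registers while the configuration `s`, the `h`-th of the queue, is
extended by the job `v`. -/
structure SweepState (n m : ℕ) (R : ℕ → ℕ → Prop) [DecidableRel R] (M h s v : ℕ) (T : Tables)
    (st : State) : Prop where
  reg0 : st.reg 0 = n
  reg1 : st.reg 1 = m
  reg2 : st.reg 2 = h
  reg3 : st.reg 3 = T.size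
  reg4 : st.reg 4 = s
  reg5 : st.reg 5 = s / n
  reg6 : st.reg 6 = s % n
  reg7 : st.reg 7 = v
  mem : st.mem = layout n (matrix n R) T
  bounded : st.Bounded M

/-- The contents of the registers when `k` jobs have been scanned. -/
structure ScanState (n m : ℕ) (R : ℕ → ℕ → Prop) [DecidableRel R] (M h s v : ℕ) (T : Tables)
    (k : ℕ) (st : State) : Prop extends SweepState n m R M h s v T st where
  le : k ≤ n
  reg8 : st.reg 8 = k
  reg9 : st.reg 9 = s / n / 2 ^ k
  reg10_le : st.reg 10 ≤ k
  reg10 : st.reg 10 = 0 ↔ ∀ u < k, (R u v → u ∈ jobs n s) ∧ (u = v → u ∉ jobs n s)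
  reg11 : st.reg 11 = rank k R v
  reg12 : st.reg 12 = rank k R (s % n)
  reg13 : st.reg 13 = 2 ^ min k v

theorem rank_succ (k : ℕ) (R : ℕ → ℕ → Prop) [DecidableRel R] (v : ℕ) :
    rank (k + 1) R v = rank k R v + if R k v then 1 else 0 := by
  rw [rank, rank, Finset.range_add_one, filter_insert]
  split_ifs <;> simp

theorem rank_le (k : ℕ) (R : ℕ → ℕ → Prop) [DecidableRel R] (v : ℕ) : rank k R v ≤ k :=
  (card_filter_le _ _).trans (by simp)

section

variable {n m : ℕ} {R : ℕ → ℕ → Prop} [DecidableRel R] {A M h s v : ℕ} {T : Tables}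

theorem scanInit_runs (hF : Fitting n m A M) (hv : v < n) {st : State}
    (H : SweepState n m R M h s v T st) :
    ∃ st', Runs M scanInit st st' scanInit.weight ∧ ScanState n m R M h s v T 0 st' := by
  have hM := hF.le_left
  have hd : st.reg 5 ≤ M := H.bounded.reg 5
  have hfits : scanInit.Fits M st := by
    simp [scanInit, Cmd.Fits, hd]; omega
  obtain ⟨h1, h2⟩ := hfits.runs H.bounded
  refine ⟨_, h1, ⟨?_, by omega, ?_, ?_, ?_, ?_, ?_, ?_, ?_⟩⟩
  · refine ⟨?_, ?_, ?_, ?_, ?_, ?_, ?_, ?_, ?_, h2⟩ <;>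
      simp [scanInit, H.reg0, H.reg1, H.reg2, H.reg3, H.reg4, H.reg5,
        H.reg6, H.reg7, H.mem]
  all_goals simp [scanInit, H.reg5, rank]

theorem scanBody_runs (hF : Fitting n m A M) (hv : v < n) {k : ℕ} {st : State}
    (H : ScanState n m R M h s v T k st) (hk : k < n) :
    ∃ st', Runs M scanBody st st' scanBody.weight ∧ ScanState n m R M h s v T (k + 1) st' := by
  have hM := hF.le_left
  have hl : s % n < n := Nat.mod_lt _ (by omega)
  obtain ⟨b, hb⟩ : ∃ b, s / n / 2 ^ k - 2 * (s / n / 2 ^ k / 2) = b := ⟨_, rfl⟩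
  have hb1 : b = if k ∈ jobs n s then 1 else 0 := by
    simp only [mem_jobs, Nat.testBit_eq_decide_div_mod_eq, ← hb, decide_eq_true_eq]
    split_ifs <;> omega
  -- `x` tells whether `k` prevents adding `v`: either `k` is an unscheduled predecessor, or `k` is
  -- `v` and is already scheduled. The product of truncated differences tests equality.
  obtain ⟨x, hx⟩ : ∃ x, (if R k v then 1 else 0) * (1 - b) +
    b * ((1 - (k - v)) * (1 - (v - k))) = x := ⟨_, rfl⟩
  have hx1 : x ≤ 1 := by
    rw [← hx, hb1]
    split_ifs <;> simp <;>
    exact (Nat.mul_le_mul (Nat.sub_le 1 (k - v)) (Nat.sub_le 1 (v - k)))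
  have hx0 : x = 0 ↔ (R k v → k ∈ jobs n s) ∧ (k = v → k ∉ jobs n s) := by
    rw [← hx, hb1]
    by_cases hkj : k ∈ jobs n s <;> by_cases hR : R k v <;> simp [hkj, hR] <;> omega
  have hpw : 2 ^ min k v + 2 ^ min k v * (1 - (1 - (v - k))) = 2 ^ min (k + 1) v := by
    rcases lt_or_ge k v with h | h
    · rw [min_eq_left h.le, min_eq_left h, show 1 - (1 - (v - k)) = 1 by omega, pow_succ]; omega
    · rw [min_eq_right h, min_eq_right (by omega), show 1 - (1 - (v - k)) = 0 by omega]; omega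
  have hpwM : 2 ^ min (k + 1) v ≤ M :=
    (Nat.pow_le_pow_right (by norm_num) (by omega)).trans hF.two_pow_le
  have hd : s / n / 2 ^ k ≤ M := H.reg9 ▸ H.bounded.reg 9
  have hd2 : s / n / 2 ^ k / 2 ≤ M := (Nat.div_le_self _ _).trans hd
  have h10 := H.reg10_le
  have hr1 := rank_le (k + 1) R v
  have hr2 := rank_le (k + 1) R (s % n)
  have hfits : scanBody.Fits M st := by
    simp only [scanBody, Cmd.Fits, matrixAt, Cmd.sim_assign, Expr.eval_add, Expr.eval_sub,
      Expr.eval_mul, Expr.eval_div, Expr.eval_reg, Expr.eval_load, Expr.eval_one, Expr.eval_two,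
      Function.update_apply, H.reg0, H.reg6, H.reg7, H.reg8, H.reg9, H.reg11, H.reg12, H.reg13,
      H.mem, layout_matrix n R T hk hv, layout_matrix n R T hk hl, 
      Nat.reduceEqDiff, if_true, if_false, hb, hx, ← rank_succ, hpw]
    refine ⟨?_, ?_, ?_, ?_, hpwM, hd2, ?_⟩
    · rw [hb1]; split_ifs <;> omega
    all_goals omega
  obtain ⟨h1, h2⟩ := hfits.runs H.bounded
  refine ⟨_, h1, ⟨?_, by omega, ?_, ?_, ?_, ?_, ?_, ?_, ?_⟩⟩
  · refine ⟨?_, ?_, ?_, ?_, ?_, ?_, ?_, ?_, ?_, h2⟩ <;>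
      simp [scanBody, H.reg0, H.reg1, H.reg2, H.reg3, H.reg4, H.reg5,
        H.reg6, H.reg7, H.mem]
  all_goals
    simp only [scanBody, matrixAt, Cmd.sim_seq, Cmd.sim_assign, Expr.eval_add, Expr.eval_sub,
      Expr.eval_mul, Expr.eval_div, Expr.eval_reg, Expr.eval_load, Expr.eval_one, Expr.eval_two,
      Function.update_apply, H.reg0, H.reg6, H.reg7, H.reg8, H.reg9, H.reg11, H.reg12, H.reg13,
      H.mem, layout_matrix n R T hk hv, layout_matrix n R T hk hl, 
      Nat.reduceEqDiff, if_true, if_false, hb, hx, ← rank_succ, hpw]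
  · rw [Nat.div_div_eq_div_mul, pow_succ]
  · omega
  · rw [Nat.add_eq_zero_iff, H.reg10, hx0, Nat.forall_lt_succ_right]

end

end Sched

/-! ### From one extension step to the whole search -/

namespace Sched

open Finset RAM

section

variable {n m : ℕ} {R : ℕ → ℕ → Prop} [DecidableRel R] {A M h s v : ℕ} {T : Tables}

theorem SearchInv.jobs_card_le {k : ℕ} (I : SearchInv n m R h k T) {s : ℕ} (hs : T.Found s) :
    #(jobs n s) ≤ n := by
  simpa using card_le_card (I.config s hs).subset

theorem SearchInv.slot_le (hm : 1 ≤ m) {k : ℕ} (I : SearchInv n m R h k T) {s : ℕ}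
    (hs : T.Found s) : slot m (T.val s) ≤ n :=
  ((slot_le_iff hm).2 (I.val_le s)).trans (I.jobs_card_le hs)

theorem positionCmd_runs (hm : 1 ≤ m) (hR : IsJobOrder n R) (hF : Fitting n m A M) (hv : v < n)
    {k : ℕ} (I : SearchInv n m R h k T) (hs : T.Found s) (ha : Addable n R s v) {st : State}
    (H : ScanState n m R M h s v T n st) :
    ∃ st', Runs M positionCmd st st' positionCmd.weight ∧ SweepState n m R M h s v T st' ∧
      st'.reg 14 = nextPos n m R (s % n) v (T.val s) ∧ st'.reg 15 = ext n s v := by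
  have hpow : 2 ^ min n v = 2 ^ v := by rw [min_eq_right hv.le]
  have hconf := (I.config s hs).ext hR hv ha
  have hcard : #(jobs n s) + 1 ≤ n := by
    have := card_le_card hconf.subset
    rwa [jobs_ext hv ha.1, card_insert_of_notMem ha.1, card_range] at this
  have hp : nextPos n m R (s % n) v (T.val s) ≤ M :=
    (nextPos_le hm (I.val_le s)).trans ((Nat.mul_le_mul_left m (by omega)).trans hF.positions)
  -- The mask is below `2 ^ n` and so is `v`, whence the bound `2 ^ n * (n + 1)` in `Fitting`.
  have he : ext n s v ≤ M := by
    have h1 := div_lt_of_jobs_subset hconf.subset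
    rw [ext_div hv] at h1
    have h2 := Nat.mul_le_mul_right n h1.le
    have h3 := hF.states
    rw [mul_add, mul_one] at h3
    have h4 : v < 2 ^ n := hv.trans Nat.lt_two_pow_self
    unfold ext
    omega
  have hrank : rank n R v - rank n R (s % n) ≠ 0 ↔ rank n R (s % n) < rank n R v := by omega
  have hite : (if rank n R v - rank n R (s % n) ≠ 0 then m * ((T.val s + m - 1) / m) + 1
      else T.val s + 1) = nextPos n m R (s % n) v (T.val s) := by
    simp only [hrank]; rfl
  rw [ext] at he
  by_cases hlt : rank n R v - rank n R (s % n) = 0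
  · rw [if_neg (by simpa using hlt)] at hite
    have hfits : positionCmd.Fits M st := by
      simp [positionCmd, Cmd.Fits, valAt, valAddr, slotExpr, H.reg0,
        H.reg4, H.reg5, H.reg7, H.reg11, H.reg12, H.reg13, H.mem, layout_val, hlt,
        hite, hp, hpow, he]
    obtain ⟨h1, h2⟩ := hfits.runs H.bounded
    refine ⟨_, h1, ⟨?_, ?_, ?_, ?_, ?_, ?_, ?_, ?_, ?_, h2⟩, ?_, ?_⟩ <;>
      simp [positionCmd, valAt, valAddr, slotExpr, H.reg0, H.reg1, H.reg2, H.reg3,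
        H.reg4, H.reg5, H.reg6, H.reg7, H.reg11, H.reg12, H.reg13, H.mem, layout_val, hlt,
        hite, hpow, ext]
  · rw [if_pos hlt] at hite
    have hfits : positionCmd.Fits M st := by
      simp [positionCmd, Cmd.Fits, valAt, valAddr, slotExpr, H.reg0, H.reg1,
        H.reg4, H.reg5, H.reg7, H.reg11, H.reg12, H.reg13, H.mem, layout_val, hlt,
        hite, hp, hpow, he]
    obtain ⟨h1, h2⟩ := hfits.runs H.bounded
    refine ⟨_, h1, ⟨?_, ?_, ?_, ?_, ?_, ?_, ?_, ?_, ?_, h2⟩, ?_, ?_⟩ <;>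
      simp [positionCmd, valAt, valAddr, slotExpr, H.reg0, H.reg1, H.reg2, H.reg3,
        H.reg4, H.reg5, H.reg6, H.reg7, H.reg11, H.reg12, H.reg13, H.mem, layout_val, hlt,
        hite, hpow, ext]

theorem recordCmd_runs {p s' : ℕ} {st : State} (H : SweepState n m R M h s v T st)
    (h14 : st.reg 14 = p) (h15 : st.reg 15 = s') (hM : (T.record s s' p).size ≤ M) :
    ∃ st', Runs M recordCmd st st' recordCmd.weight ∧
      SweepState n m R M h s v (T.record s s' p) st' := by
  have hp : p ≤ M := h14 ▸ H.bounded.reg 14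
  have hs' : s' ≤ M := h15 ▸ H.bounded.reg 15
  have hs : s ≤ M := H.reg4 ▸ H.bounded.reg 4
  unfold Tables.record at hM ⊢
  split_ifs at hM ⊢ with c1 c2
  · change T.size + 1 ≤ M at hM
    have hfits : recordCmd.Fits M st := by
      simp [recordCmd, Cmd.Fits, valAt, valAddr, H.reg0, h14, h15, H.mem, layout_val, c1, H.reg3,
        H.reg4, hp, hs, hs', hM]
    obtain ⟨h1, h2⟩ := hfits.runs H.bounded
    refine ⟨_, h1, ⟨?_, ?_, ?_, ?_, ?_, ?_, ?_, ?_, ?_, h2⟩⟩ <;>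
      simp [recordCmd, valAt, valAddr, parAddr, queueAddr, H.reg0, h14, h15, H.mem, layout_val,
        c1, H.reg1, H.reg2, H.reg3, H.reg4, H.reg5, H.reg6, H.reg7, update_layout_val,
        update_layout_par, update_layout_queue]
    rfl
  · have c3 : T.val s' - p ≠ 0 := by omega
    have hfits : recordCmd.Fits M st := by
      simp [recordCmd, Cmd.Fits, valAt, valAddr, H.reg0, h14, h15, H.mem, layout_val, c1,
        H.reg4, hp, hs]
    obtain ⟨h1, h2⟩ := hfits.runs H.bounded
    refine ⟨_, h1, ⟨?_, ?_, ?_, ?_, ?_, ?_, ?_, ?_, ?_, h2⟩⟩ <;>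
      simp [recordCmd, valAt, valAddr, parAddr, H.reg0, h14, h15, H.mem, layout_val,
        c1, c3, H.reg1, H.reg2, H.reg3, H.reg4, H.reg5, H.reg6, H.reg7, update_layout_val,
        update_layout_par]
  · have c3 : T.val s' - p = 0 := by omega
    have hfits : recordCmd.Fits M st := by
      simp [recordCmd, Cmd.Fits, valAt, valAddr, H.reg0, h14, h15, H.mem, layout_val, c1, c3]
    obtain ⟨h1, h2⟩ := hfits.runs H.bounded
    refine ⟨_, h1, ⟨?_, ?_, ?_, ?_, ?_, ?_, ?_, ?_, ?_, h2⟩⟩ <;>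
      simp [recordCmd, valAt, valAddr, H.reg0, h14, h15, H.mem, layout_val,
        c1, c3, H.reg1, H.reg2, H.reg3, H.reg4, H.reg5, H.reg6, H.reg7]

/-- `A` bounds the number of configurations. -/
def SizeBound (n m : ℕ) (R : ℕ → ℕ → Prop) [DecidableRel R] (A : ℕ) : Prop :=
  ∀ h k T, SearchInv n m R h k T → T.size ≤ A

/-- The cost of relaxation. -/
def relaxCost : ℕ := (Expr.reg 10).weight + 1 + (1 + positionCmd.weight + recordCmd.weight)

theorem relaxCmd_runs (hm : 1 ≤ m) (hR : IsJobOrder n R) (hF : Fitting n m A M)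
    (hA : SizeBound n m R A) (hv : v < n) (I : SearchInv n m R h v T) (hh : h < T.size)
    (hs : T.queue h = s) {st : State} (H : ScanState n m R M h s v T n st) :
    ∃ st', Runs M relaxCmd st st' relaxCost ∧
      SweepState n m R M h s v (relax n m R s v T) st' := by
  have hadd : st.reg 10 = 0 ↔ Addable n R s v := by
    rw [H.reg10, Addable]
    constructor
    · intro h
      exact ⟨(h v hv).2 rfl, fun u hu => (h u (mem_range.1 hu)).1⟩
    · rintro ⟨h1, h2⟩ u hu
      exact ⟨h2 u (mem_range.2 hu), by rintro rfl; exact h1⟩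
  have I' := I.relax hm hR hh hv
  rw [hs] at I'
  have hsf : T.Found s := hs ▸ I.found h hh
  by_cases ha : Addable n R s v
  · obtain ⟨st₁, h1, h2, h3, h4⟩ := positionCmd_runs hm hR hF hv I hsf ha H
    -- The invariant after the step bounds the new queue length, so that the counter fits into a
    -- word.
    have hsz := (hA _ _ _ I').trans hF.size
    rw [relax, if_pos ha] at hsz ⊢
    obtain ⟨st₂, h5, h6⟩ := recordCmd_runs h2 h3 h4 hsz
    refine ⟨st₂, (Runs.ite_false (e := .reg 10) H.bounded (hadd.2 ha) (h1.seq h5)).mono ?_, h6⟩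
    unfold relaxCost; omega
  · rw [relax, if_neg ha]
    refine ⟨st, (Runs.ite_true (e := .reg 10) (k := 1) H.bounded (fun h => ha (hadd.1 h)) ?_).mono ?_, H.toSweepState⟩
    · exact ⟨1, .skip st, by omega⟩
    · unfold relaxCost; omega

/-- The cost of trying one job. -/
def tryCost (n : ℕ) : ℕ :=
  scanInit.weight + ((n + 1) * ((Expr.reg 0 - Expr.reg 8).weight + 1 + scanBody.weight) +
    (relaxCost + (Cmd.assign 7 (.reg 7 + 1)).weight))

theorem sweepBody_runs (hm : 1 ≤ m) (hR : IsJobOrder n R) (hF : Fitting n m A M)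
    (hA : SizeBound n m R A) (hv : v < n) (I : SearchInv n m R h v T) (hh : h < T.size)
    (hs : T.queue h = s) {st : State} (H : SweepState n m R M h s v T st) :
    ∃ st', Runs M sweepBody st st' (tryCost n) ∧
      SweepState n m R M h s (v + 1) (relax n m R s v T) st' := by
  obtain ⟨st₁, h1, H1⟩ := scanInit_runs hF hv H
  obtain ⟨k, st₂, h2, H2, hk⟩ := Runs.while (M := M) (e := .reg 0 - .reg 8) (c := scanBody)
    (fun k st => ScanState n m R M h s v T k st) n scanBody.weight
    (fun k st H => H.bounded) (fun k st H => H.le)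
    (fun k st H hk => scanBody_runs hF hv H (by simp [H.reg0, H.reg8] at hk; omega)) H1
  have : k = n := by
    simp [H2.reg0, H2.reg8] at hk
    have := H2.le
    omega
  subst this
  obtain ⟨st₃, h3, H3⟩ := relaxCmd_runs hm hR hF hA hv I hh hs H2
  have hfits : (Cmd.assign 7 (.reg 7 + 1)).Fits M st₃ := by
    have := hF.le_left
    simp [Cmd.Fits, H3.reg7]; omega
  obtain ⟨h4, h5⟩ := hfits.runs H3.bounded
  refine ⟨_, h1.seq (h2.seq (h3.seq h4)), ⟨?_, ?_, ?_, ?_, ?_, ?_, ?_, ?_, ?_, h5⟩⟩ <;>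
    simp [H3.reg0, H3.reg1, H3.reg2, H3.reg3, H3.reg4, H3.reg5, H3.reg6, H3.reg7, H3.mem]

/-- The contents of memory and registers when `h` configurations have been taken from the
queue. -/
structure SearchState (n m : ℕ) (R : ℕ → ℕ → Prop) [DecidableRel R] (M h : ℕ) (st : State) :
    Prop where
  reg0 : st.reg 0 = n
  reg1 : st.reg 1 = m
  reg2 : st.reg 2 = h
  reg3 : st.reg 3 = (search n m R h).size
  reg4 : h ≠ 0 → st.reg 4 = (search n m R h).queue (h - 1)
  reg5 : st.reg 5 = st.reg 4 / n
  mem : st.mem = layout n (matrix n R) (search n m R h)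
  bounded : st.Bounded M
  inv : SearchInv n m R h 0 (search n m R h)

theorem sub_div_mul_eq_mod (s n : ℕ) : s - s / n * n = s % n := by
  have := Nat.div_add_mod' s n
  omega

theorem sweepInit_runs {st : State} (H : SearchState n m R M h st) :
    ∃ st', Runs M sweepInit st st' sweepInit.weight ∧
      SweepState n m R M h ((search n m R h).queue h) 0 (search n m R h) st' := by
  obtain ⟨s, hs⟩ : ∃ s, (search n m R h).queue h = s := ⟨_, rfl⟩
  have hsM : s ≤ M := by
    have := H.bounded.mem (n * n + 3 * h)
    rwa [H.mem, layout_queue, hs] at this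
  have h1 : s / n ≤ M := (Nat.div_le_self _ _).trans hsM
  have h2 : s % n ≤ M := (Nat.mod_le _ _).trans hsM
  have hfits : sweepInit.Fits M st := by
    simp [sweepInit, Cmd.Fits, queueAddr, H.reg0, H.reg2, H.mem,
      layout_queue, hs, hsM, h1, sub_div_mul_eq_mod, h2]
  obtain ⟨h3, h4⟩ := hfits.runs H.bounded
  rw [hs]
  refine ⟨_, h3, ⟨?_, ?_, ?_, ?_, ?_, ?_, ?_, ?_, ?_, h4⟩⟩ <;>
    simp [sweepInit, queueAddr, H.reg0, H.reg1, H.reg2, H.reg3, H.mem, layout_queue, hs,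
      sub_div_mul_eq_mod]

/-- The cost of treating one configuration. -/
def sweepCost (n : ℕ) : ℕ :=
  sweepInit.weight + ((n + 1) * ((Expr.reg 0 - Expr.reg 7).weight + 1 + tryCost n) +
    (Cmd.assign 2 (.reg 2 + 1)).weight)

theorem searchBody_runs (hm : 1 ≤ m) (hR : IsJobOrder n R) (hF : Fitting n m A M)
    (hA : SizeBound n m R A) {st : State} (H : SearchState n m R M h st)
    (hh : h < (search n m R h).size) :
    ∃ st', Runs M searchBody st st' (sweepCost n) ∧ SearchState n m R M (h + 1) st' := by
  obtain ⟨st₁, h1, H1⟩ := sweepInit_runs H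
  obtain ⟨s, hs⟩ : ∃ s, (search n m R h).queue h = s := ⟨_, rfl⟩
  have hsw := fun k (hk : k ≤ n) => H.inv.sweep hm hR hh hk
  rw [hs] at H1 hsw
  obtain ⟨k, st₂, h2, ⟨hkn, H2⟩, hk⟩ := Runs.while (M := M) (e := .reg 0 - .reg 7) (c := sweepBody)
    (fun k st => k ≤ n ∧ SweepState n m R M h s k (sweep n m R s (search n m R h) k) st) n
    (tryCost n) (fun k st H => H.2.bounded) (fun k st H => H.1)
    (fun k st H hk => by
      have hk' : k < n := by simp [H.2.reg0, H.2.reg7] at hk; omega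
      obtain ⟨i1, i2, i3⟩ := hsw k hk'.le
      obtain ⟨st', j1, j2⟩ := sweepBody_runs hm hR hF hA hk' i1 i2 i3 H.2
      exact ⟨st', j1, hk', j2⟩) ⟨Nat.zero_le _, H1⟩
  have : k = n := by
    simp [H2.reg0, H2.reg7] at hk
    omega
  subst this
  have I := H.inv.search_succ hm hR hh
  obtain ⟨-, i2, i3⟩ := hsw k le_rfl
  have hsucc : search k m R (h + 1) = sweep k m R s (search k m R h) k := by rw [search, hs]
  have hfits : (Cmd.assign 2 (.reg 2 + 1)).Fits M st₂ := by
    have h1 := (hA _ _ _ I).trans hF.size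
    rw [hsucc] at h1
    simp [Cmd.Fits, H2.reg2]; omega
  obtain ⟨h4, h5⟩ := hfits.runs H2.bounded
  refine ⟨_, h1.seq (h2.seq h4), ⟨?_, ?_, ?_, ?_, ?_, ?_, ?_, h5, I⟩⟩ <;>
    simp [H2.reg0, H2.reg1, H2.reg2, H2.reg3, H2.reg4, H2.reg5, H2.mem, hsucc, i3]

/-- The cost of the search. -/
def searchCost (n A : ℕ) : ℕ :=
  (Cmd.assign 3 1).weight + (A + 1) * ((Expr.reg 3 - Expr.reg 2).weight + 1 + sweepCost n)

theorem searchCmd_runs (hm : 1 ≤ m) (hR : IsJobOrder n R) (hF : Fitting n m A M)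
    (hA : SizeBound n m R A) {st : State} (h0 : st.reg 0 = n) (h1 : st.reg 1 = m)
    (hreg : ∀ i, 2 ≤ i → st.reg i = 0) (hmem : st.mem = layout n (matrix n R) (search n m R 0))
    (hb : st.Bounded M) :
    ∃ h st', Runs M searchCmd st st' (searchCost n A) ∧ SearchState n m R M h st' ∧
      h = (search n m R h).size := by
  have hfits : (Cmd.assign 3 1).Fits M st := by
    have := hF.le_left
    simp [Cmd.Fits]; omega
  obtain ⟨h2, h3⟩ := hfits.runs hb
  have H0 : SearchState n m R M 0 ((Cmd.assign 3 1).sim st) := by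
    refine ⟨?_, ?_, ?_, ?_, ?_, ?_, ?_, h3, searchInv_init⟩ <;>
      simp [h0, h1, hreg, hmem, search]
  obtain ⟨h, st₂, h4, H2, hk⟩ := Runs.while (M := M) (e := .reg 3 - .reg 2) (c := searchBody)
    (fun h st => SearchState n m R M h st) A (sweepCost n)
    (fun h st H => H.bounded) (fun h st H => H.inv.le_size.trans (hA _ _ _ H.inv))
    (fun h st H hk => searchBody_runs hm hR hF hA H (by
      simp [H.reg2, H.reg3] at hk; omega)) H0
  refine ⟨h, st₂, h2.seq h4, H2, ?_⟩
  simp [H2.reg2, H2.reg3] at hk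
  have := H2.inv.le_size
  omega

/-! ### Correctness of the choice of the last job and of the reconstruction -/

/-- The configuration `b` contains all jobs, and is best among the first `k` with the mask of
`s`. -/
structure BestState (n m : ℕ) (M s : ℕ) (f : ℕ → ℕ) (T : Tables) (k b : ℕ) (st : State) :
    Prop where
  le : k ≤ n
  reg0 : st.reg 0 = n
  reg1 : st.reg 1 = m
  reg5 : st.reg 5 = s / n
  reg7 : st.reg 7 = k
  reg8 : st.reg 8 = b
  reg14 : st.reg 14 = T.val b
  mem : st.mem = layout n f T
  bounded : st.Bounded M
  found : T.Found b
  div_eq : b / n = s / n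
  val_le : ∀ v < k, T.val (s / n * n + v) ≠ 0 → T.val b ≤ T.val (s / n * n + v)

theorem bestBody_runs (hF : Fitting n m A M) {f : ℕ → ℕ} {k b : ℕ}
    (hs : jobs n s ⊆ range n) {st : State} (H : BestState n m M s f T k b st) (hk : k < n) :
    ∃ st', Runs M bestBody st st' bestBody.weight ∧ ∃ b, BestState n m M s f T (k + 1) b st' := by
  obtain ⟨x, hx⟩ : ∃ x, s / n * n + k = x := ⟨_, rfl⟩
  have hxn : x / n = s / n := by
    rw [← hx, mul_comm, Nat.mul_add_div (by omega), Nat.div_eq_of_lt hk, add_zero]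
  have hxM : x ≤ M := by
    have h1 := div_lt_of_jobs_subset hs
    have h2 := Nat.mul_le_mul_right n h1.le
    have h3 := hF.states
    rw [mul_add, mul_one] at h3
    have h4 : k < 2 ^ n := hk.trans Nat.lt_two_pow_self
    omega
  have hvM : T.val x ≤ M := by
    have := H.bounded.mem (n * n + (3 * x + 1))
    rwa [H.mem, layout_val] at this
  have hM := hF.le_left
  have hkM : k + 1 ≤ M := by omega
  by_cases hc : T.val x * (T.val b - T.val x) = 0
  · have hfits : bestBody.Fits M st := by
      simp only [bestBody, Cmd.Fits, Cmd.sim_assign, Cmd.sim_ite, Cmd.sim_seq, Expr.eval_mul,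
        Expr.eval_add, Expr.eval_sub, Expr.eval_reg, Expr.eval_load, Expr.eval_one,
        Expr.eval_three, valAt, valAddr, Function.update_apply, H.reg0, H.reg5, H.reg7, H.reg14,
        H.mem, hx, layout_val, Nat.reduceEqDiff, if_true, if_false, hc, ne_eq, not_true_eq_false,
        IsEmpty.forall_iff, true_and, implies_true, Cmd.sim_skip]
      exact ⟨hxM, hkM⟩
    obtain ⟨h1, h2⟩ := hfits.runs H.bounded
    refine ⟨_, h1, b, ⟨hk, ?_, ?_, ?_, ?_, ?_, ?_, ?_, h2, H.found, H.div_eq, ?_⟩⟩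
    iterate 7 simp [bestBody, valAt, valAddr, H.reg0, H.reg1, H.reg5, H.reg7, H.reg8, H.reg14,
        H.mem, hx, layout_val, hc, -mul_eq_zero]
    rw [Nat.forall_lt_succ_right, hx]
    refine ⟨H.val_le, fun h => ?_⟩
    rcases Nat.mul_eq_zero.1 hc with hc | hc
    · exact absurd hc h
    · omega
  · have hfits : bestBody.Fits M st := by
      simp only [bestBody, Cmd.Fits, Cmd.sim_assign, Cmd.sim_ite, Cmd.sim_seq, Expr.eval_mul,
        Expr.eval_add, Expr.eval_sub, Expr.eval_reg, Expr.eval_load, Expr.eval_one,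
        Expr.eval_three, valAt, valAddr, Function.update_apply, H.reg0, H.reg5, H.reg7, H.reg14,
        H.mem, hx, layout_val, Nat.reduceEqDiff, if_true, if_false, hc, ne_eq, not_false_eq_true,
        IsEmpty.forall_iff, and_true, forall_const]
      exact ⟨hxM, ⟨hxM, hvM⟩, hkM⟩
    obtain ⟨h1, h2⟩ := hfits.runs H.bounded
    have hc1 : T.val x ≠ 0 := fun h => hc (by rw [h, zero_mul])
    have hc2 : T.val x < T.val b := by
      by_contra h
      exact hc (by rw [Nat.sub_eq_zero_of_le (by omega), mul_zero])
    refine ⟨_, h1, x, ⟨hk, ?_, ?_, ?_, ?_, ?_, ?_, ?_, h2, .inr hc1, hxn, ?_⟩⟩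
    iterate 7 simp [bestBody, valAt, valAddr, H.reg0, H.reg1, H.reg5, H.reg7, H.reg14,
        H.mem, hx, layout_val, hc, -mul_eq_zero]
    rw [Nat.forall_lt_succ_right, hx]
    exact ⟨fun v hv h => hc2.le.trans (H.val_le v hv h), fun _ => le_rfl⟩

/-- The cost of the choice of the last job. -/
def bestCost (n : ℕ) : ℕ :=
  bestInit.weight + (n + 1) * ((Expr.reg 0 - Expr.reg 7).weight + 1 + bestBody.weight)

theorem bestCmd_runs (hF : Fitting n m A M) {f : ℕ → ℕ} (hs : jobs n s ⊆ range n)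
    (hsf : T.Found s) {st : State} (h0 : st.reg 0 = n) (h1 : st.reg 1 = m) (h4 : st.reg 4 = s)
    (h5 : st.reg 5 = s / n) (hmem : st.mem = layout n f T) (hb : st.Bounded M) :
    ∃ st', Runs M bestCmd st st' (bestCost n) ∧ ∃ b, BestState n m M s f T n b st' := by
  have hsM : s ≤ M := h4 ▸ hb.reg 4
  have hvM : T.val s ≤ M := by
    have := hb.mem (n * n + (3 * s + 1))
    rwa [hmem, layout_val] at this
  have hfits : bestInit.Fits M st := by
    simp [bestInit, Cmd.Fits, valAt, valAddr, h0, h4, hmem, layout_val, hsM, hvM]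
  obtain ⟨h2, h3⟩ := hfits.runs hb
  have H0 : BestState n m M s f T 0 s (bestInit.sim st) := by
    refine ⟨Nat.zero_le _, ?_, ?_, ?_, ?_, ?_, ?_, ?_, h3, hsf, rfl, by simp⟩ <;>
      simp [bestInit, valAt, valAddr, h0, h1, h4, h5, hmem, layout_val]
  obtain ⟨k, st₂, h6, ⟨b, H2⟩, hk⟩ := Runs.while (M := M) (e := .reg 0 - .reg 7) (c := bestBody)
    (fun k st => ∃ b, BestState n m M s f T k b st) n bestBody.weight
    (fun k st ⟨_, H⟩ => H.bounded) (fun k st ⟨_, H⟩ => H.le)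
    (fun k st ⟨_, H⟩ hk => bestBody_runs hF hs H (by
      simp [H.reg0, H.reg7] at hk; omega)) ⟨s, H0⟩
  have : k = n := by
    simp [H2.reg0, H2.reg7] at hk
    have := H2.le
    omega
  subst this
  exact ⟨st₂, h2.seq h6, b, H2⟩

/-- The contents of memory and registers during the reconstruction of the schedule `g`, when
`k` jobs have been recorded. -/
structure TraceState (n m : ℕ) (M p : ℕ) (g : ℕ → ℕ) (T : Tables) (k s : ℕ) (f : ℕ → ℕ)
    (st : State) : Prop where
  le : k + #(jobs n s) = n
  reg0 : st.reg 0 = n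
  reg1 : st.reg 1 = m
  reg8 : st.reg 8 = s
  reg14 : st.reg 14 = p
  mem : st.mem = layout n f T
  bounded : st.Bounded M
  found : T.Found s
  trace : traceBack n m T #(jobs n s) s f = g

theorem traceBody_runs (hm : 1 ≤ m) (hF : Fitting n m A M) {j k p : ℕ} {f g : ℕ → ℕ}
    (I : SearchInv n m R h j T) {st : State} (H : TraceState n m M p g T k s f st)
    (hv : T.val s ≠ 0) :
    ∃ st', Runs M traceBody st st' traceBody.weight ∧
      ∃ s f, TraceState n m M p g T (k + 1) s f st' := by
  obtain ⟨hvn, ha⟩ := I.par_addable s hv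
  have hcard : #(jobs n s) = #(jobs n (T.par s)) + 1 := by
    conv_lhs => rw [← I.ext_par s hv, jobs_ext hvn ha.1]
    rw [card_insert_of_notMem ha.1]
  have hlow : s % n < n * n := hvn.trans_le (Nat.le_mul_of_pos_left _ (by omega))
  have hM := hF.le_left
  have hsl : (T.val s + m - 1) / m ≤ M := (I.slot_le hm H.found).trans (by omega)
  have hpM : T.par s ≤ M := by
    have := H.bounded.mem (n * n + (3 * s + 2))
    rwa [H.mem, layout_par] at this
  have hfits : traceBody.Fits M st := by
    simp [traceBody, Cmd.Fits, valAt, valAddr, parAddr, slotExpr, H.reg0, H.reg1, H.reg8, H.mem,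
      layout_val, sub_div_mul_eq_mod, hsl, update_layout_low _ _ _ hlow, layout_par, hpM]
  obtain ⟨h1, h2⟩ := hfits.runs H.bounded
  refine ⟨_, h1, T.par s, Function.update f (s % n) (slot m (T.val s)),
    ⟨?_, ?_, ?_, ?_, ?_, ?_, h2, I.par_found s hv, ?_⟩⟩
  · have := H.le
    omega
  iterate 5 simp [traceBody, valAt, valAddr, parAddr, slotExpr, H.reg0, H.reg1, H.reg8, H.reg14,
      H.mem, layout_val, sub_div_mul_eq_mod, update_layout_low _ _ _ hlow, layout_par, slot]
  · rw [← H.trace, hcard, traceBack, if_neg hv]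

/-- The cost of the reconstruction. -/
def traceCost (n : ℕ) : ℕ :=
  (n + 1) * ((valAt (.reg 8)).weight + 1 + traceBody.weight)

theorem traceCmd_runs (hm : 1 ≤ m) (hF : Fitting n m A M) {j p : ℕ} {f g : ℕ → ℕ}
    (I : SearchInv n m R h j T) {st : State} (H : TraceState n m M p g T 0 s f st) :
    ∃ st', Runs M traceCmd st st' (traceCost n) ∧ st'.Bounded M ∧ st'.reg 1 = m ∧
      st'.reg 14 = p ∧ st'.mem = layout n g T := by
  obtain ⟨k, st₂, h1, ⟨s', f', H2⟩, hk⟩ := Runs.while (M := M) (e := valAt (.reg 8))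
    (c := traceBody) (fun k st => ∃ s f, TraceState n m M p g T k s f st) n traceBody.weight
    (fun k st ⟨_, _, H⟩ => H.bounded) (fun k st ⟨_, _, H⟩ => by have := H.le; omega)
    (fun k st ⟨_, _, H⟩ hk => traceBody_runs hm hF I H (by
      simpa [valAt, valAddr, H.reg0, H.reg8, H.mem, layout_val] using hk)) ⟨s, f, H⟩
  refine ⟨st₂, h1, H2.bounded, H2.reg1, H2.reg14, ?_⟩
  have hv : T.val s' = 0 := by
    simpa [valAt, valAddr, H2.reg0, H2.reg8, H2.mem, layout_val] using hk
  have hs0 : s' = 0 := H2.found.resolve_right (not_not.2 hv)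
  have := H2.trace
  rw [hs0] at this
  simp only [jobs_zero, card_empty, traceBack] at this
  rw [H2.mem, this]

end

end Sched

/-! ### Correctness and cost of the whole program -/

namespace Sched

open Finset RAM

section

variable {n m : ℕ} {R : ℕ → ℕ → Prop} [DecidableRel R] {A M : ℕ}

/-- When the queue is exhausted, its last entry contains all jobs. -/
theorem SearchInv.jobs_last (hm : 1 ≤ m) (hR : IsJobOrder n R) {T : Tables}
    (I : SearchInv n m R T.size 0 T) : jobs n (T.queue (T.size - 1)) = range n := by
  have hsub := (I.config _ (I.found (T.size - 1) (by have := I.queue_zero.1; omega))).subset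
  rcases Nat.eq_zero_or_pos n with rfl | hn
  · simpa using hsub
  have hmul : ∀ a b, a < b → a * n + n ≤ b * n := fun a b h => by
    rw [← Nat.succ_mul]; exact Nat.mul_le_mul_right n h
  -- One job per slot, ordered by rank with ties broken by index, is a schedule. It shows that some
  -- configuration with all jobs is found, and the sorted queue then ends in one.
  have hinj : ∀ u < n, ∀ v < n, rank n R u * n + u = rank n R v * n + v → u = v := by
    intro u hu v hv huv
    rcases lt_trichotomy (rank n R u) (rank n R v) with h | h | h
    · have := hmul _ _ h; omega
    · rw [h] at huv; omega
    · have := hmul _ _ h; omega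
  have hslot : ∀ t, #{u ∈ range n | rank n R u * n + u + 1 = t} ≤ m := fun t =>
    le_trans (card_le_one.2 fun u hu v hv => by
      simp only [mem_filter, mem_range] at hu hv
      exact hinj u hu.1 v hv.1 (by omega)) hm
  have hlt : ∀ u v, R u v → rank n R u * n + u + 1 < rank n R v * n + v + 1 := by
    intro u v h
    have := hmul _ _ (hR.rank_lt h)
    have := hR.lt_left _ _ h
    omega
  obtain ⟨s, h1, h2, -, -⟩ := I.exists_le hm hR (fun u _ => by omega) hslot hlt hn
  obtain ⟨i, hi, rfl⟩ := I.exists_queue s h1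
  have := I.sorted i (T.size - 1) (by omega) (by omega)
  rw [h2] at this
  exact eq_of_subset_of_card_le hsub this

/-- The cost of the program. -/
def schedulerCost (n A : ℕ) : ℕ :=
  searchCost n A + (bestCost n + (traceCost n + (Cmd.assign 0 (slotExpr (.reg 14))).weight))

theorem scheduler_runs (hm : 1 ≤ m) (hR : IsJobOrder n R) (hF : Fitting n m A M)
    (hA : SizeBound n m R A) {st : State} (h0 : st.reg 0 = n) (h1 : st.reg 1 = m)
    (hreg : ∀ i, 2 ≤ i → st.reg i = 0) (hmem : st.mem = layout n (matrix n R) (search n m R 0))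
    (hb : st.Bounded M) :
    ∃ (st' : State) (T : Tables) (b : ℕ) (pos : ℕ → ℕ),
      Runs M scheduler st st' (schedulerCost n A) ∧ IsPlan n m R T b pos ∧
      jobs n b = range n ∧ st'.reg 0 = slot m (T.val b) ∧
      (∀ u < n, st'.mem u = slot m (pos u)) ∧
      ∀ (t : ℕ) (σ : ℕ → ℕ), (∀ u < n, 1 ≤ σ u) → (∀ u < n, σ u ≤ t) →
        (∀ t, #{u ∈ range n | σ u = t} ≤ m) → (∀ u v, R u v → σ u < σ v) →
        slot m (T.val b) ≤ t := by
  obtain ⟨h, st₁, r1, H1, hh⟩ := searchCmd_runs hm hR hF hA h0 h1 hreg hmem hb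
  have I := H1.inv
  have hmem1 := H1.mem
  have h4 := H1.reg4
  obtain ⟨T, hT⟩ : ∃ T, search n m R h = T := ⟨_, rfl⟩
  rw [hT] at I hmem1 h4 hh
  rw [hh] at I h4
  have hsz := I.queue_zero.1
  have h4 := h4 (by omega)
  have hlast := I.jobs_last hm hR
  obtain ⟨s, hs⟩ : ∃ s, T.queue (T.size - 1) = s := ⟨_, rfl⟩
  have hsf : T.Found s := hs ▸ I.found (T.size - 1) (by omega)
  rw [hs] at h4 hlast
  obtain ⟨st₂, r2, b, H2⟩ := bestCmd_runs hF hlast.le hsf H1.reg0 H1.reg1 h4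
    (by rw [H1.reg5, h4]) hmem1 H1.bounded
  have hjb : jobs n b = range n := by rw [jobs, H2.div_eq, ← jobs, hlast]
  obtain ⟨pos, hpos, htr⟩ := I.exists_plan hm hR rfl H2.found
  obtain ⟨st₃, r3, hb3, h31, h314, hmem3⟩ := traceCmd_runs hm hF (p := T.val b) I
    (s := b) (f := matrix n R) ⟨by rw [hjb]; simp, H2.reg0, H2.reg1, H2.reg8, H2.reg14, H2.mem,
      H2.bounded, H2.found, rfl⟩
  have hfits : (Cmd.assign 0 (slotExpr (.reg 14))).Fits M st₃ := by
    have h5 := I.slot_le hm H2.found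
    have h6 := hF.le_left
    unfold slot at h5
    simp [Cmd.Fits, slotExpr, h31, h314]; omega
  obtain ⟨r4, -⟩ := hfits.runs hb3
  refine ⟨_, T, b, pos, r1.seq (r2.seq (r3.seq r4)), hpos, hjb, ?_, ?_, ?_⟩
  · simp [slotExpr, h31, h314, slot]
  · intro u hu
    have hlow : u < n * n := hu.trans_le (Nat.le_mul_of_pos_left _ (by omega))
    simp only [Cmd.sim_assign, hmem3]
    rw [layout_low _ _ _ hlow, htr, hjb, if_pos (mem_range.2 hu)]
  · intro t σ hσ1 hσt hσm hσR
    rcases Nat.eq_zero_or_pos n with rfl | hn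
    · refine ((slot_le_iff hm).2 (I.val_le b)).trans ?_
      rw [hjb]; simp
    · obtain ⟨x, hxf, hxj, hxn, hxv⟩ := I.exists_le hm hR hσ1 hσm hσR hn
      -- The dominating configuration has the same mask as `s`, so it is among the candidates
      -- compared.
      have hxs : s / n * n + x % n = x := by
        rw [← sum_jobs, hlast, ← hxj, sum_jobs, Nat.div_add_mod']
      have hx0 : T.val x ≠ 0 := by
        rcases hxf with rfl | hx
        · rw [jobs_zero] at hxj
          have := congrArg card hxj
          simp at this
          omega
        · exact hx
      have hle := H2.val_le (x % n) hxn
      rw [hxs] at hle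
      exact (slot_le_iff hm).2 ((hle hx0).trans (hxv.trans
        (Nat.mul_le_mul_left m (hσt _ hxn))))

/-- The deepest nesting is queue entry, job tried, job scanned, whence `(A + 1) * (n + 1) ^ 2`; all
weights are constants of the fixed program. -/
theorem exists_schedulerCost_le :
    ∃ K, ∀ n A, schedulerCost n A ≤ K * ((n + 1) ^ 2 * (A + 1)) := by
  unfold schedulerCost searchCost bestCost traceCost sweepCost tryCost
  generalize (Cmd.assign 3 1).weight = a
  generalize (Expr.reg 3 - Expr.reg 2).weight = b
  generalize sweepInit.weight = c
  generalize (Expr.reg 0 - Expr.reg 7).weight = d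
  generalize scanInit.weight = e
  generalize (Expr.reg 0 - Expr.reg 8).weight = f
  generalize scanBody.weight = g
  generalize relaxCost = h
  generalize (Cmd.assign 7 (.reg 7 + 1)).weight = i
  generalize (Cmd.assign 2 (.reg 2 + 1)).weight = j
  generalize bestInit.weight = k
  generalize bestBody.weight = l
  generalize (valAt (.reg 8)).weight = o
  generalize traceBody.weight = q
  generalize (Cmd.assign 0 (slotExpr (.reg 14))).weight = r
  refine ⟨(a + k + r) + (d + 1 + l + o + 1 + q) + (b + 1 + c + j) + (d + 1 + e + h + i)
    + (f + 1 + g), fun n A => ?_⟩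
  obtain ⟨x, hx⟩ : ∃ x, n + 1 = x := ⟨_, rfl⟩
  obtain ⟨y, hy⟩ : ∃ y, A + 1 = y := ⟨_, rfl⟩
  rw [hx, hy]
  have hx1 : 1 ≤ x := by omega
  have hy1 : 1 ≤ y := by omega
  have m1 : 1 ≤ x ^ 2 * y := Nat.mul_pos (by positivity) hy1
  have m2 : y ≤ x ^ 2 * y := Nat.le_mul_of_pos_left _ (by positivity)
  have m3 : x ≤ x ^ 2 * y := by nlinarith [Nat.mul_le_mul hx1 hy1]
  have m4 : x * y ≤ x ^ 2 * y := Nat.mul_le_mul_right _ (by nlinarith)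
  calc _ = (a + k + r) * 1 + (d + 1 + l + o + 1 + q) * x + (b + 1 + c + j) * y
        + (d + 1 + e + h + i) * (x * y) + (f + 1 + g) * (x ^ 2 * y) := by ring
    _ ≤ (a + k + r) * (x ^ 2 * y) + (d + 1 + l + o + 1 + q) * (x ^ 2 * y)
        + (b + 1 + c + j) * (x ^ 2 * y) + (d + 1 + e + h + i) * (x ^ 2 * y)
        + (f + 1 + g) * (x ^ 2 * y) := by gcongr
    _ = _ := by ring

end

/-! ### The number of configurations -/

section

variable {n : ℕ} (prec : Fin n → Fin n → Prop)

/-- The precedence relation on natural numbers. -/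
def natPrec (u v : ℕ) : Prop := ∃ (hu : u < n) (hv : v < n), prec ⟨u, hu⟩ ⟨v, hv⟩

theorem isJobOrder_natPrec [IsStrictOrder (Fin n) prec] : IsJobOrder n (natPrec prec) where
  lt_left := fun _ _ h => h.1
  lt_right := fun _ _ h => h.2.1
  irrefl := fun u ⟨hu, _, h⟩ => irrefl_of prec ⟨u, hu⟩ h
  trans := fun _ _ _ ⟨hu, _, h⟩ ⟨_, hw, h'⟩ => ⟨hu, hw, trans_of prec h h'⟩

open Classical in
/-- The maximal elements of a set of jobs. -/
noncomputable def maxJobs (S : Finset ℕ) : Finset (Fin n) :=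
  {j | (j : ℕ) ∈ S ∧ ∀ w ∈ S, ¬ natPrec prec j w}

theorem isAntichain_maxJobs (S : Finset ℕ) :
    IsAntichain prec (maxJobs prec S : Set (Fin n)) := by
  intro i hi j hj _ h
  simp only [maxJobs, coe_filter, mem_univ, true_and, Set.mem_ofPred_eq] at hi hj
  exact hi.2 j hj.1 ⟨i.2, j.2, h⟩

/-- A lower set is recovered from its maximal elements: above `u`, an element of largest rank in the
set is maximal. -/
theorem mem_iff_of_maxJobs [IsStrictOrder (Fin n) prec] {S : Finset ℕ} (hS : S ⊆ range n)
    (hlow : ∀ u v, natPrec prec u v → v ∈ S → u ∈ S) (u : ℕ) :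
    u ∈ S ↔ ∃ j ∈ maxJobs prec S, u = j ∨ natPrec prec u j := by
  classical
  have hR := isJobOrder_natPrec prec
  constructor
  · intro hu
    obtain ⟨w, hw, hmax⟩ := exists_max_image {w ∈ S | u = w ∨ natPrec prec u w}
      (rank n (natPrec prec)) ⟨u, by simp [hu]⟩
    rw [mem_filter] at hw
    refine ⟨⟨w, mem_range.1 (hS hw.1)⟩, ?_, hw.2⟩
    simp only [maxJobs, mem_filter, mem_univ, true_and]
    refine ⟨hw.1, fun z hz h => ?_⟩
    have h1 := hR.rank_lt h
    have h2 := hmax z (mem_filter.2 ⟨hz, .inr ?_⟩)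
    · omega
    · rcases hw.2 with rfl | h'
      · exact h
      · exact hR.trans _ _ _ h' h
  · rintro ⟨j, hj, h⟩
    simp only [maxJobs, mem_filter, mem_univ, true_and] at hj
    rcases h with rfl | h
    · exact hj.1
    · exact hlow _ _ h hj.1

/-- Needed only to see that queue indices fit into a word. -/
theorem numAntichains_le : numAntichains prec ≤ 2 ^ n := by
  classical
  refine (Set.ncard_le_ncard (Set.subset_univ _) (Set.toFinite _)).trans ?_
  rw [Set.ncard_univ, Nat.card_eq_fintype_card]
  simp

theorem one_le_numAntichains : 1 ≤ numAntichains prec := by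
  rw [numAntichains, Nat.one_le_iff_ne_zero]
  exact Set.ncard_ne_zero_of_mem (a := ∅) (by simp)

/-- Queue entries are distinct and determined by the maximal elements and the last job. The factor
is `n + 1` because for `n = 0` the start configuration still counts. -/
theorem sizeBound_natPrec [IsStrictOrder (Fin n) prec] (m : ℕ) [DecidableRel (natPrec prec)] :
    SizeBound n m (natPrec prec) (numAntichains prec * (n + 1)) := by
  classical
  intro h k T I
  have hfin : {X : Finset (Fin n) | IsAntichain prec (X : Set (Fin n))}.Finite := Set.toFinite _
  rw [numAntichains, Set.ncard_eq_toFinset_card _ hfin]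
  have : #(hfin.toFinset ×ˢ range (n + 1)) = #hfin.toFinset * (n + 1) := by
    rw [card_product, card_range]
  rw [← this, ← card_range T.size]
  refine card_le_card_of_injOn
    (fun i => (maxJobs prec (jobs n (T.queue i)), T.queue i % n)) ?_ ?_
  · intro i hi
    have hi : i < T.size := by simpa using hi
    simp only [coe_product, Set.mem_prod, mem_coe, Set.Finite.mem_toFinset, Set.mem_ofPred_eq,
      mem_range]
    refine ⟨isAntichain_maxJobs prec _, ?_⟩
    rcases I.found i hi with h0 | h0
    · rw [h0]; simp
    · have := (I.par_addable _ h0).1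
      omega
  · intro i hi j hj hij
    have hi : i < T.size := by simpa using hi
    have hj : j < T.size := by simpa using hj
    simp only [Prod.mk.injEq] at hij
    have ci := I.config _ (I.found i hi)
    have cj := I.config _ (I.found j hj)
    refine I.inj i hi j hj (eq_of_jobs_eq ?_ hij.2)
    ext u
    rw [mem_iff_of_maxJobs prec ci.subset ci.lower, hij.1,
      ← mem_iff_of_maxJobs prec cj.subset cj.lower]

/-! ### The main theorem -/

theorem inputState_mem (m : ℕ) [DecidableRel (natPrec prec)] :
    (inputState n m prec).mem =
      layout n (matrix n (natPrec prec)) (search n m (natPrec prec) 0) := by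
  funext a
  by_cases ha : a < n * n
  · rw [layout_low _ _ _ ha, matrix]
    simp only [inputState]
    congr 1
    have hn : 0 < n := Nat.pos_of_ne_zero (by rintro rfl; simp at ha)
    refine propext ⟨?_, ?_⟩
    · rintro ⟨i, j, rfl, h⟩
      have h1 : ((i : ℕ) * n + j) / n = i := by
        rw [mul_comm, Nat.mul_add_div hn, Nat.div_eq_of_lt j.2, add_zero]
      have h2 : ((i : ℕ) * n + j) % n = j := by
        rw [mul_comm, Nat.mul_add_mod, Nat.mod_eq_of_lt j.2]
      rw [h1, h2]
      exact ⟨i.2, j.2, h⟩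
    · rintro ⟨hu, hv, h⟩
      exact ⟨⟨_, hu⟩, ⟨_, hv⟩, (Nat.div_add_mod' a n).symm, h⟩
  · have : ¬ ∃ i j : Fin n, a = (i : ℕ) * n + j ∧ prec i j := by
      rintro ⟨i, j, rfl, -⟩
      have := Nat.mul_le_mul_right n (show (i : ℕ) + 1 ≤ n from i.2)
      rw [add_mul] at this
      omega
    simp [inputState, this, layout, ha, search]

/-- Positions give a schedule. -/
theorem IsPlan.isSchedule {m : ℕ} (hm : 1 ≤ m) [DecidableRel (natPrec prec)] {T : Tables}
    {b : ℕ} {pos : ℕ → ℕ} (H : IsPlan n m (natPrec prec) T b pos) (hb : jobs n b = range n)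
    {σ : Fin n → ℕ} (hσ : ∀ j, σ j = slot m (pos j)) :
    IsSchedule prec m (slot m (T.val b)) σ := by
  have hj : ∀ j : Fin n, (j : ℕ) ∈ jobs n b := fun j => by rw [hb]; exact mem_range.2 j.2
  have hpos : ∀ j : Fin n, 1 ≤ slot m (pos j) := by
    intro j
    by_contra hc
    have := (slot_le_iff hm).1 (show slot m (pos j) ≤ 0 by omega)
    have := H.one_le j (hj j)
    omega
  refine ⟨fun j => by rw [hσ]; exact hpos j,
    fun j => by rw [hσ]; exact slot_mono (H.pos_le j (hj j)), fun t => ?_, fun i j h => ?_⟩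
  · rcases Nat.eq_zero_or_pos t with rfl | ht
    · rw [filter_false_of_mem]
      · simp
      · intro j _
        rw [hσ]
        have := hpos j
        omega
    -- Slot `t` consists of these `m` positions, and distinct jobs have distinct positions.
    · have hcard : #(Ioc (m * (t - 1)) (m * t)) = m := by
        obtain ⟨c, rfl⟩ : ∃ c, t = c + 1 := ⟨t - 1, by omega⟩
        rw [Nat.card_Ioc, mul_add]
        simp
      rw [← hcard]
      refine card_le_card_of_injOn (fun j => pos j) ?_ ?_
      · intro j hjt
        have hjt : slot m (pos j) = t := by simpa [hσ] using hjt
        have h1 := (slot_le_iff (p := pos j) (k := t) hm).1 (by omega)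
        have h2 := (slot_le_iff (p := pos j) (k := t - 1) hm).not.1 (by omega)
        exact mem_Ioc.2 ⟨not_le.1 h2, h1⟩
      · intro i _ j _ h
        exact Fin.ext (H.inj i (hj i) j (hj j) h)
  · rw [hσ, hσ]
    exact H.lt i (hj i) j (hj j) ⟨i.2, j.2, h⟩

theorem IsSchedule.card_filter_range_le {m T : ℕ} {σ : Fin n → ℕ} (H : IsSchedule prec m T σ)
    (t : ℕ) : #{u ∈ range n | (if h : u < n then σ ⟨u, h⟩ else 0) = t} ≤ m := by
  refine le_trans ?_ (H.card_slot_le t)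
  rw [← card_map Fin.valEmbedding]
  refine card_le_card fun u hu => ?_
  obtain ⟨hu, h⟩ := mem_filter.1 hu
  rw [mem_range] at hu
  rw [dif_pos hu] at h
  exact mem_map.2 ⟨⟨u, hu⟩, by simpa using h, rfl⟩

end

/-- The word length is linear in the input size because the adjacency matrix already has `n ^ 2 ≥ n`
bits. -/
theorem size_le_of_fitting (n m : ℕ) :
    (2 ^ n * (n + 1) + m * (n + 1)).size + 1 ≤ 2 * (inputSize n m + 2) := by
  have h1 : (2 ^ n * (n + 1) + m * (n + 1)).size ≤ 2 * n + m.size + 1 := by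
    rw [Nat.size_le, ← add_mul]
    have h2 : n + 1 ≤ 2 ^ n := Nat.lt_two_pow_self
    have h3 := Nat.lt_size_self m
    have h4 : 2 ^ n ≤ 2 ^ (n + m.size) := Nat.pow_le_pow_right (by norm_num) (by omega)
    have h5 : 2 ^ m.size ≤ 2 ^ (n + m.size) := Nat.pow_le_pow_right (by norm_num) (by omega)
    calc (2 ^ n + m) * (n + 1) < (2 * 2 ^ (n + m.size)) * 2 ^ n :=
          Nat.mul_lt_mul_of_lt_of_le (by omega) h2 (by positivity)
      _ = 2 ^ (2 * n + m.size + 1) := by ring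
  have h2 : n ≤ n ^ 2 := Nat.le_self_pow (by norm_num) n
  unfold inputSize
  omega

end Sched

theorem mainTheorem4 :
    ∃ (P : RAM.Cmd) (p : Polynomial ℕ),
      ∀ (n m : ℕ) (prec : Fin n → Fin n → Prop), IsStrictOrder (Fin n) prec → 1 ≤ m →
        ∃ (s : RAM.State) (t : ℕ),
          RAM.Exec P (Sched.inputState n m prec) s t ∧
          Sched.IsOptimalSchedule prec m (s.reg 0) (fun j => s.mem j) ∧
          (t : ℝ) ≤ ((p.eval (Sched.inputSize n m) : ℕ) : ℝ) *
            ((2 : ℝ) ^ ((n : ℤ) - (m : ℤ)) + (Sched.numAntichains prec : ℝ)) := by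
  classical
  obtain ⟨K, hK⟩ := Sched.exists_schedulerCost_le
  -- Of the four factors, two come from the nested loops over jobs, one from the choice of the last
  -- job, and one from the word length, which also gives the 2.
  refine ⟨Sched.scheduler, Polynomial.C (2 * K) * (Polynomial.X + 2) ^ 4, ?_⟩
  intro n m prec hprec hm
  obtain ⟨a, ha⟩ : ∃ a, Sched.numAntichains prec = a := ⟨_, rfl⟩
  obtain ⟨M, hM⟩ : ∃ M, 2 ^ n * (n + 1) + m * (n + 1) = M := ⟨_, rfl⟩
  have ha1 : 1 ≤ a := ha ▸ Sched.one_le_numAntichains prec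
  have hA := Sched.sizeBound_natPrec prec m
  have hF : Sched.Fitting n m (a * (n + 1)) M := by
    refine ⟨by omega, by omega, ?_⟩
    have := Nat.mul_le_mul_right (n + 1) (Sched.numAntichains_le prec)
    rw [ha] at this
    omega
  have hMn := hF.le_left
  have hMm : m ≤ M := (Nat.le_mul_of_pos_right _ (by omega)).trans hF.positions
  rw [ha] at hA
  obtain ⟨st, T, b, pos, ⟨t, hex, ht⟩, hplan, hjobs, h0, hmem, hopt⟩ :=
    Sched.scheduler_runs hm (Sched.isJobOrder_natPrec prec) hF hA
      (st := Sched.inputState n m prec) (by simp [Sched.inputState]) (by simp [Sched.inputState])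
      (fun i hi => by
        simp only [Sched.inputState]
        rw [if_neg (by omega), if_neg (by omega)])
      (Sched.inputState_mem prec m)
      ⟨fun i => by simp only [Sched.inputState]; split_ifs <;> omega,
        fun i => by simp only [Sched.inputState]; split_ifs <;> omega⟩
  refine ⟨st, t, hex, ⟨?_, fun T' σ' H => ?_⟩, ?_⟩
  · rw [h0]
    exact hplan.isSchedule prec hm hjobs fun j => hmem j j.2
  · rw [h0]
    refine hopt T' (fun u => if h : u < n then σ' ⟨u, h⟩ else 0) (fun u hu => ?_) (fun u hu => ?_)
      H.card_filter_range_le ?_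
    · simp only [dif_pos hu]; exact H.one_le _
    · simp only [dif_pos hu]; exact H.le_makespan _
    · rintro u v ⟨hu, hv, h⟩
      simp only [dif_pos hu, dif_pos hv]; exact H.lt_of_prec _ _ h
  · obtain ⟨N, hN⟩ : ∃ N, Sched.inputSize n m = N := ⟨_, rfl⟩
    have hsize := Sched.size_le_of_fitting n m
    rw [hM, hN] at hsize
    have hnN : n ≤ N := by
      have : n ≤ n ^ 2 := Nat.le_self_pow (by norm_num) n
      rw [← hN, Sched.inputSize]; omega
    have h1 : a * (n + 1) + 1 ≤ (N + 2) * a := by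
      have := Nat.mul_le_mul_right a hnN
      nlinarith
    have h2 : t ≤ 2 * K * (N + 2) ^ 4 * a := by
      calc t ≤ K * ((n + 1) ^ 2 * (a * (n + 1) + 1)) * (M.size + 1) :=
            ht.trans (Nat.mul_le_mul_right _ (hK _ _))
        _ ≤ K * ((N + 2) ^ 2 * ((N + 2) * a)) * (2 * (N + 2)) := by
            gcongr
            omega
        _ = 2 * K * (N + 2) ^ 4 * a := by ring
    have h3 : (Polynomial.C (2 * K) * (Polynomial.X + 2) ^ 4 : Polynomial ℕ).eval N
        = 2 * K * (N + 2) ^ 4 := by simp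
    rw [ha, hN, h3]
    calc (t : ℝ) ≤ ((2 * K * (N + 2) ^ 4 * a : ℕ) : ℝ) := by exact_mod_cast h2
      _ = ((2 * K * (N + 2) ^ 4 : ℕ) : ℝ) * (a : ℝ) := by push_cast; ring
      -- The number of antichains alone suffices; the positive power of two is simply added.
      _ ≤ _ := by
        gcongr
        have : (0 : ℝ) < (2 : ℝ) ^ ((n : ℤ) - (m : ℤ)) := by positivity
        linarith
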